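/- Fix $\alpha>0$ and write $y_+=\max(y,0)$. For $\theta>0$ let $c^{-2}(x)=1+\theta x_+^\alpha$, $\phi(x)=\int_0^x \frac{dy}{c(y)}$, $v^>=c^{1/2}e^{-i\phi}$ and $v^<=c^{1/2}e^{i\phi}$. For $\sigma\in\mathbb R$ consider the equation $$u''+(1+i\sigma)^2c^{-2}(x)\,u=0,\qquad x\in\mathbb R,\ u\in C^2. \tag{$E_\sigma$}$$ A nonzero solution $u$ of $(E_0)$ is called *outgoing to $+\infty$* (resp. *outgoing to $-\infty$*) if there are solutions $u(\cdot;\sigma)$ of $(E_\sigma)$, $\sigma<0$, that tend to $0$ as $x\to+\infty$ (resp. $x\to-\infty$) and converge to $u$ uniformly on compact sets as $\sigma\to0^-$. It is called *incoming from $-\infty$* if there are solutions $u(\cdot;\sigma)$ of $(E_\sigma)$, $\sigma>0$, that tend to $0$ as $x\to-\infty$ and converge to $u$ uniformly on compact sets as $\sigma\to0^+$. Let $u^<_{-\infty}$ (resp. $u^>_{-\infty}$) be outgoing to (resp. incoming from) $-\infty$, normalized by $u^<_{-\infty}/v^<\to1$ (resp. $u^>_{-\infty}/v^>\to1$) as $x\to-\infty$.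 If $u$ is outgoing to $+\infty$ and $u=A\,u^<_{-\infty}+B\,u^>_{-\infty}$, the reflection coefficient is $R=A/B$. Theorem. Let $\alpha>0$. There are $\theta_0>0$ and $C$, depending only on $\alpha$, such that the following holds. (1) For $0<\theta<\theta_0$ the reflection coefficient $R(\theta)$ is well defined (these waves exist, such $A,B$ exist, $B\ne0$, and $A/B$ does not depend on the choice of the waves), and $$\Big|R(\theta)-\frac{\Gamma(\alpha+1)}{(2i)^{\alpha+2}}\,\theta\Big|\le C\,\theta^{1+\min(1/\alpha,1)}$$ (principal branch of the power). (2) Let $c_0,\ell,\omega>0$ and $k_2,k_3\in\mathbb R$ with $\eta^2:=c_0^2(k_2^2+k_3^2)/\omega^2<1$. Consider the wave equation $c^{-2}\partial_t^2u=\Delta u$ on $\mathbb R\times\mathbb R^3$ with $c^{-2}(\mathbf x)=c_0^{-2}\,[1+(x_1/\ell)_+^\alpha]$, and its solutions of the form $e^{i(1+i\sigma)(\omega t-k_2x_2-k_3x_3)}U(x_1)$, $U\in C^2$. Define the reflection coefficient as above from the profiles $U$ (with $\sigma=0$ and $\sigma\to0^{\pm}$), with $v^>$, $v^<$ replaced by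 $e^{-ik_1x_1}$, $e^{ik_1x_1}$, where $k_1=(\omega^2/c_0^2-k_2^2-k_3^2)^{1/2}$. Put $$\theta(\omega,k_2,k_3)=\Big(\frac{c_0}{\ell\omega}\Big)^{\alpha}(1-\eta^2)^{-\frac{\alpha+2}{2}}.$$ If $\theta(\omega,k_2,k_3)<\theta_0$, this reflection coefficient is well defined and equal to $R(\theta(\omega,k_2,k_3))$. (3) Let $c_0,\ell,\delta>0$. On the non-glancing set $\{\xi=(\omega,k_2,k_3):\omega>0,\ \eta^2\le1-\delta\}$ one has $\theta(\xi)<\theta_0$ for all large $|\xi|$, and the Fourier multiplier $\xi\mapsto R(\theta(\xi))$ is of order $-\alpha$: as $|\xi|\to\infty$ in this set, $$R(\theta(\xi))=O(|\xi|^{-\alpha}),\qquad R(\theta(\xi))=\frac{\Gamma(\alpha+1)}{(2i)^{\alpha+2}}\,\theta(\xi)+O\big(|\xi|^{-\alpha-\min(\alpha,1)}\big),$$ with constants depending only on $\alpha,c_0,\ell,\delta$. -/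

import Mathlib

open Filter Topology

namespace FractionalReflector

noncomputable section

/-! ### Polarized solutions and the reflection coefficient

Time dependence is `exp (i ω t)`.  The argument `S` is a family of linear wave equations in one
variable: `S σ u` says that `u` solves the equation whose wave number has been complexified by the
factor `1 + i σ`; the undamped equation is `S 0`.  Below it is instantiated twice. -/

/-- Limiting absorption principle.  The nonzero solution `u` of the undamped equation is a limit,
uniformly on compact sets, as `σ → 0` with `σ` in `T`, of solutions of the complexified equations
that tend to `0` along `l`. -/
def IsPolarized (S : ℝ → (ℝ → ℂ) → Prop) (l : Filter ℝ) (T : Set ℝ) (u : ℝ → ℂ) : Prop :=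
  u ≠ 0 ∧ S 0 u ∧ ∃ U : ℝ → ℝ → ℂ,
    (∀ σ ∈ T, S σ (U σ) ∧ Tendsto (U σ) l (𝓝 0)) ∧ TendstoLocallyUniformly U u (𝓝[T] 0)

/-- Outgoing to `+∞` (transmitted wave). -/
def IsOutgoingPlus (S : ℝ → (ℝ → ℂ) → Prop) (u : ℝ → ℂ) : Prop :=
  IsPolarized S atTop (Set.Iio 0) u

/-- Outgoing to `-∞` (reflected wave). -/
def IsOutgoingMinus (S : ℝ → (ℝ → ℂ) → Prop) (u : ℝ → ℂ) : Prop :=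
  IsPolarized S atBot (Set.Iio 0) u

/-- Incoming from `-∞` (incident wave). -/
def IsIncomingMinus (S : ℝ → (ℝ → ℂ) → Prop) (u : ℝ → ℂ) : Prop :=
  IsPolarized S atBot (Set.Ioi 0) u

/-- The incident wave incoming from `-∞`, normalized by the reference wave `vInc`. -/
def IsNormalizedIncident (S : ℝ → (ℝ → ℂ) → Prop) (vInc u : ℝ → ℂ) : Prop :=
  IsIncomingMinus S u ∧ Tendsto (fun x => u x / vInc x) atBot (𝓝 1)

/-- The reflected wave outgoing to `-∞`, normalized by the reference wave `vRef`. -/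
def IsNormalizedReflected (S : ℝ → (ℝ → ℂ) → Prop) (vRef u : ℝ → ℂ) : Prop :=
  IsOutgoingMinus S u ∧ Tendsto (fun x => u x / vRef x) atBot (𝓝 1)

/-- The reflection coefficient is well defined and equal to `r`: the transmitted, reflected and
incident waves exist, and however they are chosen, the transmitted wave is a combination
`uT = A • uR + B • uI` of the normalized reflected and incident waves, where `B ≠ 0` and
`r = A / B`. -/
def IsReflectionCoefficient (S : ℝ → (ℝ → ℂ) → Prop) (vInc vRef : ℝ → ℂ) (r : ℂ) : Prop :=
  (∃ uT, IsOutgoingPlus S uT) ∧ (∃ uR, IsNormalizedReflected S vRef uR) ∧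
    (∃ uI, IsNormalizedIncident S vInc uI) ∧
    ∀ uT uR uI : ℝ → ℂ, IsOutgoingPlus S uT → IsNormalizedReflected S vRef uR →
      IsNormalizedIncident S vInc uI →
      (∃ A B : ℂ, uT = A • uR + B • uI) ∧
        ∀ A B : ℂ, uT = A • uR + B • uI → B ≠ 0 ∧ r = A / B

/-! ### The nondimensional model -/

/-- `c⁻²(x) = 1 + θ x₊ ^ α`. -/
def invSqSpeed (α θ x : ℝ) : ℝ := 1 + θ * (max x 0) ^ α

/-- `u'' + (1 + i σ)² c⁻² u = 0` on the whole line, in the classical sense. -/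
def IsModelSolution (α θ σ : ℝ) (u : ℝ → ℂ) : Prop :=
  ContDiff ℝ 2 u ∧ ∀ x : ℝ,
    deriv (deriv u) x + (1 + Complex.I * (σ : ℂ)) ^ 2 * (invSqSpeed α θ x : ℂ) * u x = 0

/-- The phase `φ(x) = ∫₀ˣ dy / c(y)`. -/
def phase (α θ x : ℝ) : ℝ := ∫ y in (0 : ℝ)..x, Real.sqrt (invSqSpeed α θ y)

/-- The amplitude `b = c ^ (1/2)`. -/
def amplitude (α θ x : ℝ) : ℝ := (invSqSpeed α θ x) ^ (-(1 / 4) : ℝ)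

/-- The right-going WKB wave `b exp (-i φ)`. -/
def wkbRight (α θ x : ℝ) : ℂ :=
  (amplitude α θ x : ℂ) * Complex.exp (-Complex.I * (phase α θ x : ℂ))

/-- The left-going WKB wave `b exp (i φ)`. -/
def wkbLeft (α θ x : ℝ) : ℂ :=
  (amplitude α θ x : ℂ) * Complex.exp (Complex.I * (phase α θ x : ℂ))

/-- `r` is the reflection coefficient of the model equation with parameters `α` and `θ`. -/
def IsModelReflectionCoefficient (α θ : ℝ) (r : ℂ) : Prop :=
  IsReflectionCoefficient (IsModelSolution α θ) (wkbRight α θ) (wkbLeft α θ) r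

/-- The coefficient `Γ(α + 1) / (2 i) ^ (α + 2)` (principal branch). -/
def leadingCoefficient (α : ℝ) : ℂ :=
  (Real.Gamma (α + 1) : ℂ) / (2 * Complex.I) ^ ((α + 2 : ℝ) : ℂ)

/-! ### The layered medium in three dimensions -/

/-- `c⁻²(x) = c₀⁻² (1 + (x₁ / ℓ)₊ ^ α)`. -/
def layeredInvSqSpeed (c₀ ℓ α x₁ : ℝ) : ℝ := (c₀ ^ 2)⁻¹ * (1 + (max (x₁ / ℓ) 0) ^ α)

/-- The wave equation `c⁻² ∂ₜ² u = Δ u` on `ℝ × ℝ³`. -/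
def SolvesWaveEquation (c₀ ℓ α : ℝ) (u : ℝ → ℝ → ℝ → ℝ → ℂ) : Prop :=
  ∀ t x₁ x₂ x₃ : ℝ,
    (layeredInvSqSpeed c₀ ℓ α x₁ : ℂ) * deriv (deriv fun s => u s x₁ x₂ x₃) t =
      deriv (deriv fun y => u t y x₂ x₃) x₁ + deriv (deriv fun y => u t x₁ y x₃) x₂ +
        deriv (deriv fun y => u t x₁ x₂ y) x₃

/-- `U` is the profile in `x₁` of a harmonic wave
`exp (i (1 + i σ) (ω t - k₂ x₂ - k₃ x₃)) U(x₁)` of the layered medium. -/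
def IsLayeredMode (c₀ ℓ α ω k₂ k₃ σ : ℝ) (U : ℝ → ℂ) : Prop :=
  ContDiff ℝ 2 U ∧ SolvesWaveEquation c₀ ℓ α fun t x₁ x₂ x₃ =>
    Complex.exp (Complex.I * (1 + Complex.I * (σ : ℂ)) *
      ((ω * t - k₂ * x₂ - k₃ * x₃ : ℝ) : ℂ)) * U x₁

/-- The normal wave number `k₁ = (ω² / c₀² - k₂² - k₃²) ^ (1/2)` in `x₁ < 0`. -/
def normalWaveNumber (c₀ ω k₂ k₃ : ℝ) : ℝ := Real.sqrt (ω ^ 2 / c₀ ^ 2 - k₂ ^ 2 - k₃ ^ 2)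

/-- `r` is the reflection coefficient of the layered medium for the incident plane wave
`exp (i (ω t - k₁ x₁ - k₂ x₂ - k₃ x₃))` and the reflected plane wave
`exp (i (ω t + k₁ x₁ - k₂ x₂ - k₃ x₃))`. -/
def IsLayeredReflectionCoefficient (c₀ ℓ α ω k₂ k₃ : ℝ) (r : ℂ) : Prop :=
  IsReflectionCoefficient (IsLayeredMode c₀ ℓ α ω k₂ k₃)
    (fun x₁ => Complex.exp (-Complex.I * ((normalWaveNumber c₀ ω k₂ k₃ * x₁ : ℝ) : ℂ)))
    (fun x₁ => Complex.exp (Complex.I * ((normalWaveNumber c₀ ω k₂ k₃ * x₁ : ℝ) : ℂ))) r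

/-- `θ = (c₀ / (ℓ ω)) ^ α (1 - η²) ^ (-(α + 2) / 2)`, where `η² = c₀² (k₂² + k₃²) / ω²`. -/
def layeredTheta (c₀ ℓ α ω k₂ k₃ : ℝ) : ℝ :=
  (c₀ / (ℓ * ω)) ^ α * (1 - c₀ ^ 2 * (k₂ ^ 2 + k₃ ^ 2) / ω ^ 2) ^ (-(α + 2) / 2)

/-- The non-glancing frequencies `(ω, k₂, k₃)`: `ω > 0` and `η² ≤ 1 - δ`. -/
def nonGlancing (c₀ δ : ℝ) : Set (ℝ × ℝ × ℝ) :=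
  {ξ | 0 < ξ.1 ∧ c₀ ^ 2 * (ξ.2.1 ^ 2 + ξ.2.2 ^ 2) / ξ.1 ^ 2 ≤ 1 - δ}

/-- The Euclidean length of a frequency vector `(ω, k₂, k₃)`. -/
def freqNorm (ξ : ℝ × ℝ × ℝ) : ℝ := Real.sqrt (ξ.1 ^ 2 + ξ.2.1 ^ 2 + ξ.2.2 ^ 2)

/-- The Fourier multiplier `p` has order `m` at high frequencies in `G`: it is `O(|ξ| ^ m)`, so
that it gains `-m` derivatives on the Sobolev scale. -/
def HasMultiplierOrder (m : ℝ) (G : Set (ℝ × ℝ × ℝ)) (p : ℝ × ℝ × ℝ → ℂ) : Prop :=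
  ∃ K ρ : ℝ, 0 < ρ ∧ ∀ ξ ∈ G, ρ ≤ freqNorm ξ → ‖p ξ‖ ≤ K * freqNorm ξ ^ m

end

end FractionalReflector

/-!
The proof compares logarithmic derivatives at the origin. For `x ≤ 0` the medium is homogeneous, and
the reflected and incident waves are `exp (i x)` and `exp (-i x)` there; so if `m = u'(0) / u(0)` for
the transmitted wave `u`, matching `u` and `u'` at `0` gives `R = (1 - i m) / (1 + i m)`
(`reflectionCoeff`, `isModelReflectionCoefficient`). It remains to construct `m` and to expand it in
`θ`.

*Dissipative equations.* If for some `ω` the flux `Im (ω ū u')` of every solution of `u'' + V u = 0`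
on `x ≥ 0` increases at a rate at least `c (|u|² + |u'|²)`, then bounded solutions have nonpositive
flux, decay exponentially, and form a line, obtained as a limit of Dirichlet problems
(`exists_isWeylCoeff`). Their logarithmic derivative at `0` is the Weyl coefficient of `V`. By the
Wronskian identity, its variation under a change `ΔV` of the potential is, to first order,
`∫ ΔV u²`, with a remainder quadratic in `ΔV` whose constant involves only `c`
and the unperturbed solution (`IsWeylSol.norm_weylCoeff_sub_le`).

*Complex scaling.* For `σ < 0` the damped equation is dissipative, but `c → 0` as `σ → 0`. Replacing
`V(x) = P + Q x ^ α` by the potential that corresponds to the turned half line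
`exp (-i s) [0, ∞)` multiplies the Weyl coefficient by `exp (-i s)` (`IsWeylCoeff.rotate`). This is
proved without continuing solutions to complex `x`: by the first order formula the Weyl coefficient
is differentiable in `s`, and the virial identity computes its derivative. With
`s = π / (2 (α + 2))` the turned equation is dissipative uniformly for `-1 ≤ σ ≤ 0`
(`isDissipative_scaledPot`), which yields the limit `σ → 0⁻`, that is, the transmitted wave, and at
the same time uniform estimates for small `θ`.

*Expansion.* At `θ = 0` the decaying solution on the turned half line is a complex exponential, and
the first variation in `θ` is a Gamma integral (`integral_rpow_mul_cexp`); hence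
`R = Γ(α + 1) (2 i) ^ (-α - 2) θ + O(θ²)`, for every `α > 0`. The claimed exponent
`1 + min (1 / α) 1` is at most `2`.

*Layered medium.* Separation of variables and the unit of length `1 / k₁` turn the layered equation
into the model equation with parameter `layeredTheta` (`isLayeredMode_comp_mul_iff`), and
`layeredTheta` is `O(|ξ| ^ (-α))` away from glancing incidence.
-/

namespace FractionalReflector

open MeasureTheory Set Asymptotics

/-! ### Linear ordinary differential equations -/

/-- The terms of the Picard series of the initial value problem `Y' = A Y`, `Y 0 = y₀`. -/
noncomputable def picardTerm {E : Type*} [NormedAddCommGroup E] [NormedSpace ℝ E]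
    (A : ℝ → E →L[ℝ] E) (y₀ : E) : ℕ → ℝ → E
  | 0 => fun _ => y₀
  | n + 1 => fun x => ∫ t in (0 : ℝ)..x, A t (picardTerm A y₀ n t)

section Picard

variable {E : Type*} [NormedAddCommGroup E] [NormedSpace ℝ E]
  {A : ℝ → E →L[ℝ] E} {y₀ : E}

theorem continuous_picardTerm (hA : Continuous A) (n : ℕ) : Continuous (picardTerm A y₀ n) := by
  induction n with
  | zero => exact continuous_const
  | succ n ih =>
    exact intervalIntegral.continuous_primitive
      (fun a b => (hA.clm_apply ih).intervalIntegrable a b) 0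

theorem norm_picardTerm_le {M X : ℝ} (hM : ∀ t, |t| ≤ X → ‖A t‖ ≤ M)
    (n : ℕ) {x : ℝ} (hx : |x| ≤ X) :
    ‖picardTerm A y₀ n x‖ ≤ ‖y₀‖ * ((M * |x|) ^ n / n.factorial) := by
  induction n generalizing x with
  | zero => simp [picardTerm]
  | succ n ih =>
    have hM0 : 0 ≤ M := (norm_nonneg _).trans (hM x hx)
    have hsub : picardTerm A y₀ (n + 1) x =
        x • ∫ s in (0 : ℝ)..1, A (x * s) (picardTerm A y₀ n (x * s)) := by
      rw [intervalIntegral.smul_integral_comp_mul_left (fun t => A t (picardTerm A y₀ n t))]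
      simp [picardTerm]
    have hint : ‖∫ s in (0 : ℝ)..1, A (x * s) (picardTerm A y₀ n (x * s))‖ ≤
        ∫ s in (0 : ℝ)..1, M * (‖y₀‖ * ((M * |x|) ^ n / n.factorial)) * s ^ n := by
      refine intervalIntegral.norm_integral_le_of_norm_le zero_le_one ?_
        (Continuous.intervalIntegrable (by fun_prop) _ _)
      refine Eventually.of_forall fun s hs => ?_
      have hs0 : 0 ≤ s := hs.1.le
      have hxs : |x * s| ≤ |x| := by
        rw [abs_mul, abs_of_nonneg hs0]
        exact mul_le_of_le_one_right (abs_nonneg x) hs.2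
      have h1 := ih (hxs.trans hx)
      calc ‖A (x * s) (picardTerm A y₀ n (x * s))‖
          ≤ ‖A (x * s)‖ * ‖picardTerm A y₀ n (x * s)‖ := ContinuousLinearMap.le_opNorm _ _
        _ ≤ M * (‖y₀‖ * ((M * |x * s|) ^ n / n.factorial)) := by
            gcongr
            exact hM _ (hxs.trans hx)
        _ = M * (‖y₀‖ * ((M * |x|) ^ n / n.factorial)) * s ^ n := by
            rw [abs_mul, abs_of_nonneg hs0]; ring
    rw [hsub, norm_smul, Real.norm_eq_abs]
    refine (mul_le_mul_of_nonneg_left hint (abs_nonneg x)).trans_eq ?_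
    rw [intervalIntegral.integral_const_mul, integral_pow, Nat.factorial_succ]
    have : (n.factorial : ℝ) ≠ 0 := by positivity
    push_cast
    field_simp
    simp [pow_succ]
    ring

variable [CompleteSpace E]

theorem hasDerivAt_picardTerm_succ (hA : Continuous A) (n : ℕ) (x : ℝ) :
    HasDerivAt (picardTerm A y₀ (n + 1)) (A x (picardTerm A y₀ n x)) x := by
  have hc := hA.clm_apply (continuous_picardTerm (y₀ := y₀) hA n)
  exact intervalIntegral.integral_hasDerivAt_right (hc.intervalIntegrable _ _)
    hc.stronglyMeasurable.stronglyMeasurableAtFilter hc.continuousAt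

/-- Global solvability of linear equations with continuous coefficients. -/
theorem exists_hasDerivAt_linear (hA : Continuous A) (y₀ : E) :
    ∃ Y : ℝ → E, Y 0 = y₀ ∧ ∀ x, HasDerivAt Y (A x (Y x)) x := by
  refine ⟨fun x => ∑' n, picardTerm A y₀ n x, ?_, fun x => ?_⟩
  · have : ∀ n, n ≠ 0 → picardTerm A y₀ n 0 = 0 := by
      rintro (_ | n) hn
      · exact absurd rfl hn
      · simp [picardTerm]
    change ∑' n, picardTerm A y₀ n 0 = y₀
    rw [tsum_eq_single 0 this]
    rfl
  · set X : ℝ := |x| + 1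
    have hX : 0 < X := by positivity
    obtain ⟨M, hM⟩ : ∃ M, ∀ t, |t| ≤ X → ‖A t‖ ≤ M := by
      obtain ⟨M, hM⟩ := (isCompact_Icc (a := -X) (b := X)).exists_bound_of_continuousOn
        hA.continuousOn
      exact ⟨M, fun t ht => hM t (abs_le.1 ht)⟩
    have hM0 : 0 ≤ M := (norm_nonneg _).trans (hM 0 (by simpa using hX.le))
    let b : ℕ → ℝ := fun n => ‖y₀‖ * ((M * X) ^ n / n.factorial)
    have hb : Summable b := (Real.summable_pow_div_factorial (M * X)).mul_left _
    have hle : ∀ n t, |t| ≤ X → ‖picardTerm A y₀ n t‖ ≤ b n := fun n t ht =>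
      (norm_picardTerm_le hM n ht).trans (by simp only [b]; gcongr)
    have hsum : ∀ t, |t| ≤ X → Summable fun n => picardTerm A y₀ n t := fun t ht =>
      Summable.of_norm_bounded hb fun n => hle n t ht
    have hxX : |x| ≤ X := by simp [X]
    have hd : HasDerivAt (fun z => ∑' n, picardTerm A y₀ (n + 1) z)
        (∑' n, A x (picardTerm A y₀ n x)) x := by
      refine hasDerivAt_tsum_of_isPreconnected (t := Metric.ball 0 X) (y₀ := 0)
        (g' := fun n z => A z (picardTerm A y₀ n z)) (hb.mul_left M) Metric.isOpen_ball
        (convex_ball 0 X).isPreconnected (fun n z _ => hasDerivAt_picardTerm_succ hA n z)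
        (fun n z hz => ?_) (Metric.mem_ball_self hX) ?_ ?_
      · have hz' : |z| ≤ X := by simpa using (mem_ball_zero_iff.1 hz).le
        exact (ContinuousLinearMap.le_opNorm _ _).trans
          (mul_le_mul (hM z hz') (hle n z hz') (norm_nonneg _) hM0)
      · simp [picardTerm]
      · simp [X]
    have hsplit : ∀ t, |t| ≤ X → ∑' n, picardTerm A y₀ n t =
        y₀ + ∑' n, picardTerm A y₀ (n + 1) t := fun t ht => (hsum t ht).tsum_eq_zero_add
    rw [ContinuousLinearMap.map_tsum _ (hsum x hxX)]
    refine (hd.const_add y₀).congr_of_eventuallyEq ?_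
    filter_upwards [Metric.ball_mem_nhds x one_pos] with t ht
    refine hsplit t ?_
    have := abs_sub_abs_le_abs_sub t x
    rw [Metric.mem_ball, Real.dist_eq] at ht
    simp only [X]; linarith

end Picard

/-! ### Second order equations -/

/-- `u` solves `u'' + V u = 0` on the whole line, and `v` is its derivative. -/
structure IsSol (V u v : ℝ → ℂ) : Prop where
  hu : ∀ x, HasDerivAt u (v x) x
  hv : ∀ x, HasDerivAt v (-(V x * u x)) x

namespace IsSol

variable {V u v w z : ℝ → ℂ}

theorem continuous (h : IsSol V u v) : Continuous u :=
  continuous_iff_continuousAt.2 fun x => (h.hu x).continuousAt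

theorem continuous_deriv (h : IsSol V u v) : Continuous v :=
  continuous_iff_continuousAt.2 fun x => (h.hv x).continuousAt

theorem lincomb (h : IsSol V u v) (h' : IsSol V w z) (a b : ℂ) :
    IsSol V (fun x => a * u x + b * w x) (fun x => a * v x + b * z x) where
  hu x := ((h.hu x).const_mul a).add ((h'.hu x).const_mul b)
  hv x := (((h.hv x).const_mul a).add ((h'.hv x).const_mul b)).congr_deriv (by ring)

theorem reflect (h : IsSol V u v) :
    IsSol (fun x => V (-x)) (fun x => u (-x)) (fun x => -v (-x)) where
  hu x := by simpa [Function.comp_def] using (h.hu (-x)).scomp x (hasDerivAt_neg x)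
  hv x := ((h.hv (-x)).scomp x (hasDerivAt_neg x)).neg.congr_deriv (by simp)

end IsSol

theorem exists_isSol {V : ℝ → ℂ} (hV : Continuous V) (a b : ℂ) :
    ∃ u v, IsSol V u v ∧ u 0 = a ∧ v 0 = b := by
  let A : ℝ → (ℂ × ℂ) →L[ℝ] (ℂ × ℂ) := fun t =>
    (ContinuousLinearMap.inl ℝ ℂ ℂ).comp (ContinuousLinearMap.snd ℝ ℂ ℂ) -
      V t • (ContinuousLinearMap.inr ℝ ℂ ℂ).comp (ContinuousLinearMap.fst ℝ ℂ ℂ)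
  have hA : Continuous A := by fun_prop
  obtain ⟨Y, h0, hY⟩ := exists_hasDerivAt_linear hA (a, b)
  refine ⟨fun x => (Y x).1, fun x => (Y x).2, ⟨fun x => ?_, fun x => ?_⟩, by simp [h0],
    by simp [h0]⟩
  · simpa [A, Function.comp_def] using
      (ContinuousLinearMap.fst ℝ ℂ ℂ).hasFDerivAt.comp_hasDerivAt x (hY x)
  · simpa [A, Function.comp_def] using
      (ContinuousLinearMap.snd ℝ ℂ ℂ).hasFDerivAt.comp_hasDerivAt x (hY x)

/-- Continuous dependence of solutions on the potential and on the data at `0`, to the right. -/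
theorem IsSol.norm_sub_le_of_nonneg {V V₀ u v u₀ v₀ : ℝ → ℂ} (h : IsSol V u v)
    (h₀ : IsSol V₀ u₀ v₀) {M X δ ε : ℝ} (hε : 0 ≤ ε) (hM0 : 0 ≤ M)
    (hM : ∀ x ∈ Icc 0 X, ‖V x‖ ≤ M)
    (hd : ∀ x ∈ Icc 0 X, ‖(V x - V₀ x) * u₀ x‖ ≤ ε) (hu : ‖u 0 - u₀ 0‖ ≤ δ)
    (hv : ‖v 0 - v₀ 0‖ ≤ δ) {x : ℝ} (hx : x ∈ Icc 0 X) :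
    ‖u x - u₀ x‖ ≤ (δ + ε) * Real.exp ((1 + M) * X) := by
  have hder : ∀ x, HasDerivAt (fun x => (u x - u₀ x, v x - v₀ x))
      (v x - v₀ x, -(V x * (u x - u₀ x)) - (V x - V₀ x) * u₀ x) x := fun x =>
    ((h.hu x).sub (h₀.hu x)).prodMk
      (((h.hv x).sub (h₀.hv x)).congr_deriv (by ring))
  have key := norm_le_gronwallBound_of_norm_deriv_right_le (δ := δ) (K := 1 + M) (ε := ε)
    (a := 0) (b := X) (fun x _ => (hder x).continuousAt.continuousWithinAt)
    (fun x _ => (hder x).hasDerivWithinAt) (by simp [Prod.norm_def, hu, hv]) (fun x hx => ?_) x hx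
  · have h1 : ‖u x - u₀ x‖ ≤ ‖(u x - u₀ x, v x - v₀ x)‖ := norm_fst_le (_, _)
    refine h1.trans (key.trans ?_)
    have hK : 1 + M ≠ 0 := by positivity
    rw [gronwallBound_of_K_ne_0 hK, sub_zero]
    have he : Real.exp ((1 + M) * x) ≤ Real.exp ((1 + M) * X) := by gcongr; exact hx.2
    have hδ : 0 ≤ δ := (norm_nonneg _).trans hu
    have h2 : ε / (1 + M) ≤ ε := div_le_self hε (by linarith)
    have h3 : 0 ≤ Real.exp ((1 + M) * x) - 1 := by
      have := Real.one_le_exp (x := (1 + M) * x) (mul_nonneg (by linarith) hx.1)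
      linarith
    calc δ * Real.exp ((1 + M) * x) + ε / (1 + M) * (Real.exp ((1 + M) * x) - 1)
        ≤ δ * Real.exp ((1 + M) * X) + ε * Real.exp ((1 + M) * X) := by
          gcongr; linarith
      _ = _ := by ring
  · have hxX := Ico_subset_Icc_self hx
    have h1 : ‖u x - u₀ x‖ ≤ ‖(u x - u₀ x, v x - v₀ x)‖ := norm_fst_le (_, _)
    have h2 : ‖v x - v₀ x‖ ≤ ‖(u x - u₀ x, v x - v₀ x)‖ := norm_snd_le (_, _)
    set N := ‖(u x - u₀ x, v x - v₀ x)‖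
    have hN : 0 ≤ N := norm_nonneg _
    refine norm_prod_le_iff.2 ⟨?_, ?_⟩
    · have := mul_nonneg hM0 hN
      change ‖v x - v₀ x‖ ≤ _
      linarith
    · refine (norm_sub_le _ _).trans ?_
      rw [norm_neg, norm_mul]
      have := mul_le_mul (hM x hxX) h1 (norm_nonneg _) hM0
      have := hd x hxX
      linarith

/-- Continuous dependence of solutions on the potential and on the data at `0`. -/
theorem IsSol.norm_sub_le {V V₀ u v u₀ v₀ : ℝ → ℂ} (h : IsSol V u v)
    (h₀ : IsSol V₀ u₀ v₀) {M X δ ε : ℝ} (hε : 0 ≤ ε) (hM0 : 0 ≤ M)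
    (hM : ∀ x, |x| ≤ X → ‖V x‖ ≤ M)
    (hd : ∀ x, |x| ≤ X → ‖(V x - V₀ x) * u₀ x‖ ≤ ε) (hu : ‖u 0 - u₀ 0‖ ≤ δ)
    (hv : ‖v 0 - v₀ 0‖ ≤ δ) {x : ℝ} (hx : |x| ≤ X) :
    ‖u x - u₀ x‖ ≤ (δ + ε) * Real.exp ((1 + M) * X) := by
  rcases le_total 0 x with h0 | h0
  · refine h.norm_sub_le_of_nonneg h₀ hε hM0 (fun y hy => hM y ?_) (fun y hy => hd y ?_) hu hv
      ⟨h0, (le_abs_self x).trans hx⟩ <;> exact abs_le.2 ⟨by linarith [hy.1, hy.2], hy.2⟩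
  · have := h.reflect.norm_sub_le_of_nonneg h₀.reflect (x := -x) (X := X) (δ := δ) hε hM0
      (fun y hy => hM _ ?_) (fun y hy => hd _ ?_) (by simpa using hu)
      (by simpa [neg_add_eq_sub, norm_sub_rev] using hv)
      ⟨by linarith, (neg_le_abs x).trans hx⟩
    · simpa using this
    all_goals exact abs_le.2 ⟨by linarith [hy.2], by linarith [hy.1, hy.2]⟩

theorem IsSol.eq_of_data_eq {V u v w z : ℝ → ℂ} (hV : Continuous V) (h : IsSol V u v)
    (h' : IsSol V w z) (h0 : u 0 = w 0) (h1 : v 0 = z 0) : u = w ∧ v = z := by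
  have huw : u = w := by
    funext x
    obtain ⟨M, hM⟩ := (isCompact_Icc (a := -|x|) (b := |x|)).exists_bound_of_continuousOn
      hV.continuousOn
    have hM' : ∀ t, |t| ≤ |x| → ‖V t‖ ≤ M := fun t ht => hM t (abs_le.1 ht)
    have := h.norm_sub_le h' (δ := 0) (ε := 0) le_rfl ((norm_nonneg _).trans (hM' x le_rfl)) hM'
      (by simp) (by simp [h0]) (by simp [h1]) (le_refl |x|)
    simpa [sub_eq_zero] using this
  refine ⟨huw, ?_⟩
  funext x
  exact (h.hu x).unique (huw ▸ h'.hu x)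

/-! ### The energy of a dissipative equation on the half line -/

theorem le_of_hasDerivAt_nonneg {f f' : ℝ → ℝ} {a b : ℝ} (hab : a ≤ b)
    (hf : ∀ x ∈ Icc a b, HasDerivAt f (f' x) x) (hf' : ∀ x ∈ Icc a b, 0 ≤ f' x) : f a ≤ f b := by
  refine monotoneOn_of_deriv_nonneg (convex_Icc a b)
    (fun x hx => (hf x hx).continuousAt.continuousWithinAt)
    (fun x hx => (hf x (interior_subset hx)).differentiableAt.differentiableWithinAt)
    (fun x hx => ?_) (left_mem_Icc.2 hab) (right_mem_Icc.2 hab) hab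
  rw [(hf x (interior_subset hx)).deriv]
  exact hf' x (interior_subset hx)

/-- On the half line `x ≥ 0` the equation `u'' + V u = 0` is dissipative, with constant `c`, in the
direction `ω`: the flux `Im (ω ū u')` of every solution grows at least at the rate
`c (|u|² + |u'|²)`. -/
structure IsDissipative (c : ℝ) (ω : ℂ) (V : ℝ → ℂ) : Prop where
  pos : 0 < c
  norm_le : ‖ω‖ ≤ 2
  le_im : c ≤ ω.im
  im_mul_le : ∀ x, 0 ≤ x → (ω * V x).im ≤ -c

/-- The flux `Im (ω ū v)`. -/
def flux (ω : ℂ) (u v : ℝ → ℂ) (x : ℝ) : ℝ := (ω * (starRingEnd ℂ) (u x) * v x).im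

theorem abs_flux_le {ω : ℂ} (hω : ‖ω‖ ≤ 2) (u v : ℝ → ℂ) (x : ℝ) :
    |flux ω u v x| ≤ 2 * (‖u x‖ * ‖v x‖) := by
  refine (Complex.abs_im_le_norm _).trans ?_
  rw [norm_mul, norm_mul, RCLike.norm_conj, mul_assoc]
  gcongr

theorem hasDerivAt_flux {ω a f : ℂ} {u v : ℝ → ℂ} {x : ℝ} (hu : HasDerivAt u (v x) x)
    (hv : HasDerivAt v (-(a * u x) + f) x) :
    HasDerivAt (flux ω u v) (ω.im * ‖v x‖ ^ 2 - (ω * a).im * ‖u x‖ ^ 2 +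
      (ω * (starRingEnd ℂ) (u x) * f).im) x := by
  have h1 : HasDerivAt (fun y => (starRingEnd ℂ) (u y)) ((starRingEnd ℂ) (v x)) x := by
    simpa using! Complex.conjCLE.toContinuousLinearMap.hasFDerivAt.comp_hasDerivAt x hu
  have h2 := Complex.imCLM.hasFDerivAt.comp_hasDerivAt x ((h1.const_mul ω).mul hv)
  refine HasDerivAt.congr_deriv (f := flux ω u v) h2 ?_
  rw [← Complex.normSq_eq_norm_sq, ← Complex.normSq_eq_norm_sq]
  simp [Complex.normSq_apply]
  ring

section Energy

variable {c : ℝ} {ω : ℂ} {V u v : ℝ → ℂ}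

theorem IsSol.hasDerivAt_flux (h : IsSol V u v) (x : ℝ) :
    HasDerivAt (flux ω u v) (ω.im * ‖v x‖ ^ 2 - (ω * V x).im * ‖u x‖ ^ 2) x := by
  simpa using FractionalReflector.hasDerivAt_flux (ω := ω) (a := V x) (f := 0) (h.hu x)
    (by simpa using h.hv x)

theorem IsDissipative.le_deriv_flux (hd : IsDissipative c ω V) {x : ℝ} (hx : 0 ≤ x) (a b : ℂ) :
    c * (‖a‖ ^ 2 + ‖b‖ ^ 2) ≤ ω.im * ‖b‖ ^ 2 - (ω * V x).im * ‖a‖ ^ 2 := by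
  have h1 := mul_le_mul_of_nonneg_right hd.le_im (sq_nonneg ‖b‖)
  have h2 := mul_le_mul_of_nonneg_right (hd.im_mul_le x hx) (sq_nonneg ‖a‖)
  linarith

theorem IsSol.flux_mono (h : IsSol V u v) (hd : IsDissipative c ω V) {x y : ℝ} (hx : 0 ≤ x)
    (hxy : x ≤ y) : flux ω u v x ≤ flux ω u v y :=
  le_of_hasDerivAt_nonneg hxy (fun t _ => h.hasDerivAt_flux t) fun t ht =>
    (mul_nonneg hd.pos.le (by positivity)).trans (hd.le_deriv_flux (hx.trans ht.1) (u t) (v t))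

/-- The decrease of `|u|²`, at a rate of at most `2 |u| |u'|`, is outweighed by the growth of the
flux divided by `c`. -/
theorem IsSol.normSq_add_flux_mono (h : IsSol V u v) (hd : IsDissipative c ω V) {x y : ℝ}
    (hx : 0 ≤ x) (hxy : x ≤ y) :
    ‖u x‖ ^ 2 + flux ω u v x / c ≤ ‖u y‖ ^ 2 + flux ω u v y / c := by
  refine le_of_hasDerivAt_nonneg hxy
    (fun t _ => ((h.hu t).norm_sq).add ((h.hasDerivAt_flux t).div_const c)) fun t ht => ?_
  have h1 := hd.le_deriv_flux (hx.trans ht.1) (u t) (v t)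
  have h2 : ‖u t‖ ^ 2 + ‖v t‖ ^ 2 ≤ (ω.im * ‖v t‖ ^ 2 - (ω * V t).im * ‖u t‖ ^ 2) / c := by
    rw [le_div_iff₀ hd.pos]; linarith
  have h3 := neg_le_of_abs_le (abs_real_inner_le_norm (u t) (v t))
  nlinarith [sq_nonneg (‖u t‖ - ‖v t‖)]

/-- A solution that vanishes at `N` is controlled by its flux to the left of `N`. -/
theorem IsSol.normSq_le_of_eq_zero (h : IsSol V u v) (hd : IsDissipative c ω V) {x N : ℝ}
    (hx : 0 ≤ x) (hxN : x ≤ N) (hN : u N = 0) : ‖u x‖ ^ 2 ≤ -flux ω u v x / c := by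
  have := h.normSq_add_flux_mono hd hx hxN
  simp only [hN, flux, norm_zero, map_zero, mul_zero, zero_mul, Complex.zero_im, zero_div,
    add_zero, ne_eq, OfNat.ofNat_ne_zero, not_false_eq_true, zero_pow] at this
  rw [neg_div]
  simp only [flux]
  linarith

/-- The flux of a bounded solution is nonpositive: a positive flux `E` would satisfy `E' ≥ k E²`
and blow up in finite time. -/
theorem IsSol.flux_nonpos_of_bounded (h : IsSol V u v) (hd : IsDissipative c ω V) {B : ℝ}
    (hB : ∀ x, 0 ≤ x → ‖u x‖ ≤ B) {x₀ : ℝ} (hx₀ : 0 ≤ x₀) : flux ω u v x₀ ≤ 0 := by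
  by_contra! hpos
  obtain ⟨D, hD0, hD⟩ : ∃ D : ℝ, 0 < D ∧ ∀ x, 0 ≤ x → ‖u x‖ ≤ D :=
    ⟨max B 1, by positivity, fun x hx => (hB x hx).trans (le_max_left _ _)⟩
  -- since `E ≤ 2 D |u'|` and `E' ≥ c |u'|²`, the flux `E` satisfies `E' ≥ k E²`
  set k : ℝ := c / (4 * D ^ 2)
  have hk : 0 < k := div_pos hd.pos (by positivity)
  set e := flux ω u v x₀
  set x₁ : ℝ := x₀ + 1 / (k * e)
  have hx₁ : x₀ ≤ x₁ := by
    have : 0 < 1 / (k * e) := by positivity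
    linarith
  have hE : ∀ t ∈ Icc x₀ x₁, 0 < flux ω u v t := fun t ht =>
    hpos.trans_le (h.flux_mono hd hx₀ ht.1)
  have key : -(e)⁻¹ - k * x₀ ≤ -(flux ω u v x₁)⁻¹ - k * x₁ := by
    refine le_of_hasDerivAt_nonneg (f := fun t => -(flux ω u v t)⁻¹ - k * t) hx₁ (fun t ht =>
      (((h.hasDerivAt_flux t).inv (hE t ht).ne').neg).sub ((hasDerivAt_id t).const_mul k))
      fun t ht => ?_
    have ht0 := hx₀.trans ht.1
    have hEt := hE t ht
    have h1 := hd.le_deriv_flux ht0 (u t) (v t)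
    have h2 : flux ω u v t ≤ 2 * (D * ‖v t‖) :=
      (le_abs_self _).trans ((abs_flux_le hd.norm_le u v t).trans (by gcongr; exact hD t ht0))
    have h3 : flux ω u v t ^ 2 ≤ (2 * (D * ‖v t‖)) ^ 2 := by gcongr
    have h4 : k * flux ω u v t ^ 2 ≤ ω.im * ‖v t‖ ^ 2 - (ω * V t).im * ‖u t‖ ^ 2 := by
      calc k * flux ω u v t ^ 2 ≤ k * (2 * (D * ‖v t‖)) ^ 2 := by gcongr
        _ = c * ‖v t‖ ^ 2 := by simp only [k]; field_simp; ring
        _ ≤ c * (‖u t‖ ^ 2 + ‖v t‖ ^ 2) := by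
            have := hd.pos
            gcongr
            linarith [sq_nonneg ‖u t‖]
        _ ≤ _ := h1
    have h5 : k ≤ (ω.im * ‖v t‖ ^ 2 - (ω * V t).im * ‖u t‖ ^ 2) / flux ω u v t ^ 2 := by
      rwa [le_div_iff₀ (by positivity)]
    simp only [neg_div, neg_neg, mul_one]
    linarith
  have h6 : k * x₁ = k * x₀ + e⁻¹ := by
    simp only [x₁]; field_simp
  have h7 : 0 < (flux ω u v x₁)⁻¹ := inv_pos.2 (hE x₁ (right_mem_Icc.2 hx₁))
  linarith

/-- A nonpositive flux controls the solution. -/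
theorem IsSol.normSq_le_of_flux_nonpos (h : IsSol V u v) (hd : IsDissipative c ω V)
    (hE : ∀ x, 0 ≤ x → flux ω u v x ≤ 0) {x : ℝ} (hx : 0 ≤ x) :
    ‖u x‖ ^ 2 ≤ -flux ω u v x / c := by
  -- Otherwise `|u|² ≥ a > 0` beyond `x`, and the flux grows linearly.
  by_contra! hlt
  have hc := hd.pos
  set a := ‖u x‖ ^ 2 + flux ω u v x / c
  have ha : 0 < a := by simp only [a]; rw [neg_div] at hlt; linarith
  have hle : ∀ y, x ≤ y → a ≤ ‖u y‖ ^ 2 := fun y hy => by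
    have h1 := h.normSq_add_flux_mono hd hx hy
    have h2 : flux ω u v y / c ≤ 0 := div_nonpos_of_nonpos_of_nonneg (hE y (hx.trans hy)) hc.le
    linarith
  have hy : x ≤ x + (1 - flux ω u v x) / (c * a) := by
    have : 0 ≤ (1 - flux ω u v x) / (c * a) :=
      div_nonneg (by linarith [hE x hx]) (by positivity)
    linarith
  have := le_of_hasDerivAt_nonneg (f := fun t => flux ω u v t - c * a * t) hy
    (fun t _ => (h.hasDerivAt_flux t).sub ((hasDerivAt_id t).const_mul (c * a))) fun t ht => by
      have h1 := hd.le_deriv_flux (hx.trans ht.1) (u t) (v t)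
      have h2 := hle t ht.1
      have h3 : c * a ≤ c * (‖u t‖ ^ 2 + ‖v t‖ ^ 2) := by
        gcongr; linarith [sq_nonneg ‖v t‖]
      linarith
  have h4 : c * a * (x + (1 - flux ω u v x) / (c * a)) = c * a * x + (1 - flux ω u v x) := by
    field_simp
  have h5 := hE _ (hx.trans hy)
  linarith

/-- A nonpositive flux decays exponentially, since `-E ≤ |u|² + |u'|²`. -/
theorem IsSol.neg_flux_le_of_flux_nonpos (h : IsSol V u v) (hd : IsDissipative c ω V)
    (hE : ∀ x, 0 ≤ x → flux ω u v x ≤ 0) {x : ℝ} (hx : 0 ≤ x) :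
    -flux ω u v x ≤ -flux ω u v 0 * Real.exp (-(c * x)) := by
  have hexp : ∀ t : ℝ, HasDerivAt (fun t => Real.exp (c * t)) (Real.exp (c * t) * c) t := fun t =>
    by simpa using ((hasDerivAt_id t).const_mul c).exp
  have key := le_of_hasDerivAt_nonneg (f := fun t => flux ω u v t * Real.exp (c * t)) hx
    (fun t _ => (h.hasDerivAt_flux t).mul (hexp t)) fun t ht => by
      have h1 := hd.le_deriv_flux ht.1 (u t) (v t)
      have h2 := abs_flux_le hd.norm_le u v t
      rw [abs_of_nonpos (hE t ht.1)] at h2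
      have h3 : -flux ω u v t ≤ ‖u t‖ ^ 2 + ‖v t‖ ^ 2 := by nlinarith [sq_nonneg (‖u t‖ - ‖v t‖)]
      have h4 := mul_le_mul_of_nonneg_left h3 hd.pos.le
      have h5 := Real.exp_pos (c * t)
      nlinarith
  simp only [mul_zero, Real.exp_zero, mul_one] at key
  rw [Real.exp_neg, ← div_eq_mul_inv, le_div_iff₀ (Real.exp_pos _)]
  linarith

/-- A bounded solution that vanishes at `0` has vanishing derivative there. -/
theorem IsSol.deriv_eq_zero_of_bounded (h : IsSol V u v) (hd : IsDissipative c ω V) {B : ℝ}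
    (hB : ∀ x, 0 ≤ x → ‖u x‖ ≤ B) (h0 : u 0 = 0) : v 0 = 0 := by
  have hE : ∀ x, 0 ≤ x → flux ω u v x ≤ 0 := fun x hx => h.flux_nonpos_of_bounded hd hB hx
  have hz : ∀ x ∈ Ici (0 : ℝ), u x = 0 := fun x hx => by
    have h1 := h.normSq_le_of_flux_nonpos hd hE hx
    have h2 := h.neg_flux_le_of_flux_nonpos hd hE hx
    have h3 : flux ω u v 0 = 0 := by simp [flux, h0]
    rw [h3, neg_zero, zero_mul] at h2
    have h4 : -flux ω u v x / c ≤ 0 := div_nonpos_of_nonpos_of_nonneg h2 hd.pos.le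
    have h5 : ‖u x‖ ^ 2 = 0 := le_antisymm (h1.trans h4) (sq_nonneg _)
    simpa using h5
  exact (uniqueDiffWithinAt_Ici (0 : ℝ)).eq_deriv _ (h.hu 0).hasDerivWithinAt
    ((hasDerivWithinAt_const (0 : ℝ) (Ici 0) (0 : ℂ)).congr hz h0)

end Energy

/-- The derivative of a solution is controlled by the solution and the potential. -/
theorem IsSol.norm_deriv_le {V u v : ℝ → ℂ} (h : IsSol V u v) {t C : ℝ}
    (hC : ∀ s ∈ Icc t (t + 1), ‖V s * u s‖ ≤ C) : ‖v t‖ ≤ ‖u t‖ + ‖u (t + 1)‖ + C := by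
  have h1 : ∀ s ∈ Icc t (t + 1), ‖v s - v t‖ ≤ C := fun s hs => by
    have := norm_image_sub_le_of_norm_deriv_le_segment' (f := v) (C := C) (a := t) (b := t + 1)
      (fun x _ => (h.hv x).hasDerivWithinAt)
      (fun x hx => by simpa using hC x (Ico_subset_Icc_self hx)) s hs
    have hC0 : 0 ≤ C := (norm_nonneg _).trans (hC s hs)
    nlinarith [hs.1, hs.2]
  have h2 := norm_image_sub_le_of_norm_deriv_le_segment' (f := fun s => u s - s • v t) (C := C)
    (a := t) (b := t + 1)
    (fun x _ => ((h.hu x).sub ((hasDerivAt_id x).smul_const (v t))).hasDerivWithinAt)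
    (fun x hx => by simpa using h1 x (Ico_subset_Icc_self hx)) (t + 1)
    (right_mem_Icc.2 (by linarith))
  have h3 : v t = u (t + 1) - u t - (u (t + 1) - (t + 1) • v t - (u t - t • v t)) := by
    simp only [Complex.real_smul]; push_cast; ring
  have h4 := _root_.norm_sub_le (u (t + 1) - u t) (u (t + 1) - (t + 1) • v t - (u t - t • v t))
  have h5 := _root_.norm_sub_le (u (t + 1)) (u t)
  rw [← h3] at h4
  simp only [add_sub_cancel_left, mul_one] at h2
  linarith

/-! ### Exponentially decaying functions -/

theorem bounded_of_tendsto {f : ℝ → ℂ} (hc : Continuous f) (hf : Tendsto f atTop (𝓝 0)) :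
    ∃ B, ∀ x, 0 ≤ x → ‖f x‖ ≤ B := by
  obtain ⟨T, hT⟩ := eventually_atTop.1
    ((hf.norm.eventually (eventually_le_nhds (b := 1) (by simp))))
  obtain ⟨B, hB⟩ := (isCompact_Icc (a := 0) (b := T)).exists_bound_of_continuousOn hc.continuousOn
  refine ⟨max B 1, fun x hx => ?_⟩
  rcases le_total x T with h | h
  · exact (hB x ⟨hx, h⟩).trans (le_max_left _ _)
  · exact (hT x h).trans (le_max_right _ _)

/-- Exponential decay at `+∞`, at an unspecified rate. -/
def ExpDecay (f : ℝ → ℂ) : Prop :=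
  ∃ k : ℝ, 0 < k ∧ f =O[atTop] fun t => Real.exp (-k * t)

namespace ExpDecay

variable {f g : ℝ → ℂ}

theorem of_le {K k : ℝ} (hk : 0 < k) (h : ∀ t, 0 ≤ t → ‖f t‖ ≤ K * Real.exp (-k * t)) :
    ExpDecay f :=
  ⟨k, hk, IsBigO.of_bound K <| (eventually_ge_atTop 0).mono fun t ht => by
    simpa [abs_of_pos (Real.exp_pos _)] using h t ht⟩

theorem mono (hf : ExpDecay f) (h : g =O[atTop] f) : ExpDecay g :=
  let ⟨k, hk, hO⟩ := hf
  ⟨k, hk, h.trans hO⟩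

theorem const_mul (hf : ExpDecay f) (a : ℂ) : ExpDecay fun t => a * f t :=
  hf.mono (isBigO_const_mul_self a f atTop)

theorem add (hf : ExpDecay f) (hg : ExpDecay g) : ExpDecay fun t => f t + g t := by
  obtain ⟨k, hk, hO⟩ := hf
  obtain ⟨l, hl, hO'⟩ := hg
  have hle : ∀ {a b : ℝ}, a ≤ b →
      (fun t => Real.exp (-b * t)) =O[atTop] fun t => Real.exp (-a * t) := fun hab =>
    IsBigO.of_bound 1 <| (eventually_ge_atTop 0).mono fun t ht => by
      simp only [Real.norm_eq_abs, Real.abs_exp, one_mul]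
      gcongr
  exact ⟨min k l, lt_min hk hl,
    (hO.trans (hle (min_le_left k l))).add (hO'.trans (hle (min_le_right k l)))⟩

theorem sub (hf : ExpDecay f) (hg : ExpDecay g) : ExpDecay fun t => f t - g t := by
  simpa [sub_eq_add_neg] using hf.add (hg.const_mul (-1))

theorem mul (hf : ExpDecay f) (hg : ExpDecay g) : ExpDecay fun t => f t * g t := by
  obtain ⟨k, hk, hO⟩ := hf
  obtain ⟨l, hl, hO'⟩ := hg
  refine ⟨k + l, add_pos hk hl, (hO.mul hO').congr_right fun t => ?_⟩
  rw [← Real.exp_add]; ring_nf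

theorem rpow_mul (hf : ExpDecay f) (a : ℝ) : ExpDecay fun t => ((t ^ a : ℝ) : ℂ) * f t := by
  obtain ⟨k, hk, hO⟩ := hf
  refine ⟨k / 2, half_pos hk, ?_⟩
  have h1 : (fun t : ℝ => ((t ^ a : ℝ) : ℂ)) =O[atTop] fun t => Real.exp (k / 2 * t) :=
    (isBigO_norm_left.1 <| by
      simpa using (isLittleO_rpow_exp_pos_mul_atTop a (half_pos hk)).isBigO.norm_left)
  refine (h1.mul hO).congr_right fun t => ?_
  rw [← Real.exp_add]; ring_nf

theorem norm (hf : ExpDecay f) : ExpDecay fun t => ((‖f t‖ : ℝ) : ℂ) :=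
  hf.mono (IsBigO.of_bound 1 (by simp))

theorem conj (hf : ExpDecay f) : ExpDecay fun t => (starRingEnd ℂ) (f t) :=
  hf.mono (IsBigO.of_bound 1 (by simp))

theorem comp_add_one (hf : ExpDecay f) : ExpDecay fun t => f (t + 1) := by
  obtain ⟨k, hk, hO⟩ := hf
  refine ⟨k, hk, (hO.comp_tendsto (tendsto_atTop_add_const_right _ 1 tendsto_id)).trans ?_⟩
  refine IsBigO.of_bound 1 (Eventually.of_forall fun t => ?_)
  simp only [Function.comp_apply, id, Real.norm_eq_abs, Real.abs_exp, one_mul]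
  exact Real.exp_le_exp.2 (by nlinarith)

theorem tendsto (hf : ExpDecay f) : Tendsto f atTop (𝓝 0) := by
  obtain ⟨k, hk, hO⟩ := hf
  refine hO.trans_tendsto (Real.tendsto_exp_atBot.comp ?_)
  exact tendsto_id.const_mul_atTop_of_neg (neg_lt_zero.2 hk)

theorem integrableOn (hf : ExpDecay f) (hc : ContinuousOn f (Ici 0)) :
    IntegrableOn f (Ioi 0) := by
  obtain ⟨k, hk, hO⟩ := hf
  have := integrableOn_Ici_iff_integrableOn_Ioi (μ := volume) (f := f) (b := (0 : ℝ))
  refine this.1 ((hc.locallyIntegrableOn measurableSet_Ici).integrableOn_of_isBigO_atTop hO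
    ⟨Ioi 0, Ioi_mem_atTop 0, exp_neg_integrableOn_Ioi 0 hk⟩)

theorem bounded (hf : ExpDecay f) (hc : Continuous f) : ∃ B, ∀ x, 0 ≤ x → ‖f x‖ ≤ B :=
  bounded_of_tendsto hc hf.tendsto

end ExpDecay

/-! ### The decaying solution and its logarithmic derivative at the origin -/

/-- The potential `P + Q x₊ ^ α`. -/
noncomputable def pot (α : ℝ) (P Q : ℂ) (x : ℝ) : ℂ := P + Q * (((max x 0) ^ α : ℝ) : ℂ)

theorem continuous_pot {α : ℝ} (hα : 0 < α) (P Q : ℂ) : Continuous (pot α P Q) := by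
  unfold pot
  have : Continuous fun x : ℝ => (max x 0) ^ α :=
    (continuous_id.max continuous_const).rpow_const fun _ => Or.inr hα.le
  fun_prop

theorem pot_of_nonneg {α x : ℝ} (P Q : ℂ) (hx : 0 ≤ x) :
    pot α P Q x = P + Q * ((x ^ α : ℝ) : ℂ) := by rw [pot, max_eq_left hx]

theorem pot_of_nonpos {α x : ℝ} (hα : 0 < α) (P Q : ℂ) (hx : x ≤ 0) : pot α P Q x = P := by
  rw [pot, max_eq_right hx, Real.zero_rpow hα.ne']; simp

theorem isDissipative_pot {α c : ℝ} {ω P Q : ℂ} (hc : 0 < c) (hω : ‖ω‖ ≤ 2) (h : c ≤ ω.im)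
    (hP : (ω * P).im ≤ -c) (hQ : (ω * Q).im ≤ 0) : IsDissipative c ω (pot α P Q) where
  pos := hc
  norm_le := hω
  le_im := h
  im_mul_le x hx := by
    rw [pot_of_nonneg P Q hx, mul_add, ← mul_assoc, Complex.add_im, Complex.im_mul_ofReal]
    have := mul_nonpos_of_nonpos_of_nonneg hQ (Real.rpow_nonneg hx α)
    linarith

/-- `u` is the exponentially decaying solution of `u'' + V u = 0` on the half line with `u 0 = 1`,
and `v` its derivative. The number `v 0` is the Weyl coefficient of `V`. -/
structure IsWeylSol (V u v : ℝ → ℂ) : Prop where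
  sol : IsSol V u v
  data : u 0 = 1
  decay : ExpDecay u
  decay_deriv : ExpDecay v

/-- `m = u'(0) / u(0)` for the exponentially decaying solutions `u` of `u'' + V u = 0`. -/
def IsWeylCoeff (V : ℝ → ℂ) (m : ℂ) : Prop := ∃ u v, IsWeylSol V u v ∧ v 0 = m

theorem IsSol.expDecay_deriv {α : ℝ} {P Q : ℂ} {u v : ℝ → ℂ} (h : IsSol (pot α P Q) u v)
    (hα : 0 < α) {K k : ℝ} (hk : 0 < k) (hu : ∀ t, 0 ≤ t → ‖u t‖ ≤ K * Real.exp (-k * t)) :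
    ExpDecay v := by
  have hK : 0 ≤ K := by simpa using (norm_nonneg _).trans (hu 0 le_rfl)
  have hE : ExpDecay fun t => ((K * Real.exp (-k * t) : ℝ) : ℂ) :=
    ExpDecay.of_le (K := K) hk fun t _ => by
      rw [Complex.norm_real, Real.norm_eq_abs, abs_of_nonneg (by positivity)]
  have hV : ExpDecay fun t => ((‖P‖ : ℝ) : ℂ) * ((K * Real.exp (-k * t) : ℝ) : ℂ) +
      ((‖Q‖ : ℝ) : ℂ) * ((((t + 1) ^ α : ℝ) : ℂ) *
        (((K * Real.exp k : ℝ) : ℂ) * ((Real.exp (-k * (t + 1)) : ℝ) : ℂ))) := by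
    refine (hE.const_mul _).add (ExpDecay.const_mul ?_ _)
    have := ((ExpDecay.of_le (f := fun t => ((Real.exp (-k * t) : ℝ) : ℂ)) (K := 1) hk
      fun t _ => by rw [Complex.norm_real]; simp).const_mul
        ((K * Real.exp k : ℝ) : ℂ)).rpow_mul α
    exact this.comp_add_one
  have hall := ((ExpDecay.of_le hk hu).norm.add (ExpDecay.of_le hk hu).norm.comp_add_one).add hV
  refine hall.mono (IsBigO.of_bound 1 ((eventually_ge_atTop 0).mono fun t ht => ?_))
  have hb := h.norm_deriv_le (t := t)
    (C := ‖P‖ * (K * Real.exp (-k * t)) + ‖Q‖ * ((t + 1) ^ α * (K * Real.exp (-k * t))))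
    fun s hs => by
      have hs0 : 0 ≤ s := ht.trans hs.1
      have h1 : ‖u s‖ ≤ K * Real.exp (-k * t) := (hu s hs0).trans (by
        gcongr ?_ * Real.exp ?_
        nlinarith [hs.1])
      rw [pot_of_nonneg P Q hs0, norm_mul]
      have h2 : ‖P + Q * ((s ^ α : ℝ) : ℂ)‖ ≤ ‖P‖ + ‖Q‖ * (t + 1) ^ α := by
        refine (norm_add_le _ _).trans ?_
        rw [norm_mul, Complex.norm_real, Real.norm_eq_abs, abs_of_nonneg (Real.rpow_nonneg hs0 _)]
        gcongr
        exact hs.2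
      calc _ ≤ (‖P‖ + ‖Q‖ * (t + 1) ^ α) * (K * Real.exp (-k * t)) := by gcongr
        _ = _ := by ring
  refine hb.trans ?_
  rw [one_mul]
  have h3 : Real.exp k * Real.exp (-k * (t + 1)) = Real.exp (-k * t) := by
    rw [← Real.exp_add]; ring_nf
  refine le_trans (le_of_eq ?_) (Complex.re_le_norm _)
  norm_cast
  rw [mul_assoc K, h3]

/-- A solution with nonpositive flux decays exponentially. -/
theorem IsSol.isWeylSol_of_flux_nonpos {α c : ℝ} {ω P Q : ℂ} {u v : ℝ → ℂ}
    (h : IsSol (pot α P Q) u v) (hα : 0 < α) (hd : IsDissipative c ω (pot α P Q))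
    (hE : ∀ x, 0 ≤ x → flux ω u v x ≤ 0) (h0 : u 0 = 1) : IsWeylSol (pot α P Q) u v := by
  have hc := hd.pos
  have hu : ∀ t, 0 ≤ t → ‖u t‖ ≤ Real.sqrt (-flux ω u v 0 / c) * Real.exp (-(c / 2) * t) := by
    intro t ht
    have h1 := h.normSq_le_of_flux_nonpos hd hE ht
    have h2 := h.neg_flux_le_of_flux_nonpos hd hE ht
    have h3 : 0 ≤ -flux ω u v 0 / c := div_nonneg (by linarith [hE 0 le_rfl]) hc.le
    refine abs_le_of_sq_le_sq' ?_ (by positivity) |>.2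
    rw [mul_pow, Real.sq_sqrt h3, ← Real.exp_nat_mul]
    refine h1.trans ?_
    have h4 : ((2 : ℕ) : ℝ) * (-(c / 2) * t) = -(c * t) := by push_cast; ring
    rw [h4, div_mul_eq_mul_div]
    gcongr
  exact ⟨h, h0, ExpDecay.of_le (half_pos hc) hu, h.expDecay_deriv hα (half_pos hc) hu⟩

/-- Bounded solutions are multiples of the decaying solution. -/
theorem IsWeylCoeff.deriv_eq {V u v : ℝ → ℂ} {c : ℝ} {ω m : ℂ} (hm : IsWeylCoeff V m)
    (hd : IsDissipative c ω V) (h : IsSol V u v) {B : ℝ} (hB : ∀ x, 0 ≤ x → ‖u x‖ ≤ B) :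
    v 0 = m * u 0 := by
  obtain ⟨w, z, hw, rfl⟩ := hm
  obtain ⟨B', hB'⟩ := hw.decay.bounded hw.sol.continuous
  have := (h.lincomb hw.sol 1 (-u 0)).deriv_eq_zero_of_bounded hd
    (B := B + ‖u 0‖ * B') (fun x hx => ?_) (by simp [hw.data])
  · simp only [one_mul] at this
    linear_combination this
  · refine (norm_add_le _ _).trans ?_
    rw [norm_mul, norm_mul, norm_neg, norm_one, one_mul]
    gcongr
    exacts [hB x hx, hB' x hx]

theorem IsWeylCoeff.unique {V : ℝ → ℂ} {c : ℝ} {ω m m' : ℂ} (hm : IsWeylCoeff V m)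
    (hd : IsDissipative c ω V) (hm' : IsWeylCoeff V m') : m' = m := by
  obtain ⟨w, z, hw, rfl⟩ := hm'
  obtain ⟨B, hB⟩ := hw.decay.bounded hw.sol.continuous
  simpa [hw.data] using hm.deriv_eq hd hw.sol hB

/-- The decaying solution of a dissipative equation exists: it is a limit of solutions of
Dirichlet problems on `[0, N]` as `N → ∞`. -/
theorem exists_isWeylCoeff {α c : ℝ} {ω P Q : ℂ} (hα : 0 < α)
    (hd : IsDissipative c ω (pot α P Q)) : ∃ m, IsWeylCoeff (pot α P Q) m := by
  have hc := hd.pos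
  have hV := continuous_pot hα P Q
  obtain ⟨f, f', hf, hf0, hf1⟩ := exists_isSol hV 1 0
  obtain ⟨g, g', hg, hg0, hg1⟩ := exists_isSol hV 0 1
  -- dissipation excludes Dirichlet eigenfunctions on `[0, N]`
  have hgN : ∀ N, 0 < N → g N ≠ 0 := fun N hN h0 => by
    have h1 := hg.normSq_le_of_eq_zero hd hN.le le_rfl h0
    have hz : ∀ x ∈ Icc 0 N, g x = 0 := fun x hx => by
      have h2 := hg.normSq_le_of_eq_zero hd hx.1 hx.2 h0
      have h3 := hg.flux_mono hd le_rfl hx.1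
      have h4 : flux ω g g' 0 = 0 := by simp [flux, hg0]
      have h5 : -flux ω g g' x / c ≤ 0 :=
        div_nonpos_of_nonpos_of_nonneg (by linarith) hc.le
      simpa using le_antisymm (h2.trans h5) (sq_nonneg _)
    have := (uniqueDiffOn_Icc hN 0 (left_mem_Icc.2 hN.le)).eq_deriv _ (hg.hu 0).hasDerivWithinAt
      ((hasDerivWithinAt_const (0 : ℝ) (Icc 0 N) (0 : ℂ)).congr hz hg0)
    simp [hg1] at this
  -- the Dirichlet solution on `[0, n + 1]` is `f + m n • g`
  let m : ℕ → ℂ := fun n => -f (n + 1) / g (n + 1)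
  have hsol : ∀ a : ℂ, IsSol (pot α P Q) (fun x => f x + a * g x) (fun x => f' x + a * g' x) :=
    fun a => by simpa using hf.lincomb hg 1 a
  have hzero : ∀ n : ℕ, f (n + 1) + m n * g (n + 1) = 0 := fun n => by
    have := hgN (n + 1) (by positivity)
    simp only [m]; field_simp; ring
  obtain ⟨M, hM⟩ := (isCompact_Icc (a := (0 : ℝ)) (b := 1)).exists_bound_of_continuousOn
    hV.continuousOn
  have hM0 : 0 ≤ M := (norm_nonneg _).trans (hM 0 (by simp))
  -- the flux at `0` is linear in `m n` but controls `|u|²`, and so `|m n|²`, on `[0, 1]`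
  have hbound : ∀ n, ‖m n‖ ≤ 2 * (2 + M) ^ 2 / c := fun n => by
    set u := fun x => f x + m n * g x
    set v := fun x => f' x + m n * g' x
    have h1 : IsSol (pot α P Q) u v := hsol (m n)
    have hv0 : v 0 = m n := by simp [v, hf1, hg1]
    have hu0 : u 0 = 1 := by simp [u, hf0, hg0]
    have hE0 : -flux ω u v 0 ≤ 2 * ‖m n‖ := by
      have := neg_le_of_abs_le (abs_flux_le hd.norm_le u v 0)
      rw [hu0, hv0, norm_one, one_mul] at this
      linarith
    set S := Real.sqrt (2 * ‖m n‖ / c)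
    have hS : ∀ x ∈ Icc (0 : ℝ) 1, ‖u x‖ ≤ S := fun x hx => by
      refine Real.le_sqrt_of_sq_le ?_
      have h2 := h1.normSq_le_of_eq_zero hd hx.1 (N := n + 1)
        (hx.2.trans (by linarith [Nat.cast_nonneg (α := ℝ) n])) (hzero n)
      have h3 := h1.flux_mono hd le_rfl hx.1
      refine h2.trans ?_
      gcongr
      linarith
    have h4 := h1.norm_deriv_le (t := 0) (C := M * S) fun s hs => by
      rw [zero_add] at hs
      rw [norm_mul]
      exact mul_le_mul (hM s hs) (hS s hs) (norm_nonneg _) hM0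
    rw [hv0, zero_add] at h4
    have h5 : ‖m n‖ ≤ (2 + M) * S := by
      linarith [hS 0 (by simp), hS 1 (by simp)]
    have h6 : ‖m n‖ ^ 2 ≤ (2 + M) ^ 2 * (2 * ‖m n‖ / c) := by
      have := pow_le_pow_left₀ (norm_nonneg _) h5 2
      rwa [mul_pow, Real.sq_sqrt (by positivity)] at this
    rcases (norm_nonneg (m n)).eq_or_lt with h7 | h7
    · rw [← h7]; positivity
    · have h8 : ‖m n‖ * ‖m n‖ ≤ 2 * (2 + M) ^ 2 / c * ‖m n‖ := by
        rw [← sq]; refine h6.trans_eq ?_; ring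
      exact le_of_mul_le_mul_right h8 h7
  obtain ⟨a, -, φ, hφ, hlim⟩ := tendsto_subseq_of_bounded
    (Metric.isBounded_closedBall (x := (0 : ℂ)) (r := 2 * (2 + M) ^ 2 / c))
    (fun n => mem_closedBall_zero_iff.2 (hbound n))
  refine ⟨a, _, _, (hsol a).isWeylSol_of_flux_nonpos hα hd (fun x hx => ?_) (by simp [hf0, hg0]),
    by simp [hf1, hg1]⟩
  have hcont : Continuous fun b : ℂ =>
      flux ω (fun x => f x + b * g x) (fun x => f' x + b * g' x) x := by
    unfold flux
    exact Complex.continuous_im.comp (by fun_prop)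
  refine le_of_tendsto ((hcont.tendsto a).comp hlim) ?_
  filter_upwards [eventually_ge_atTop ⌈x⌉₊] with n hn
  have h1 : x ≤ (φ n : ℝ) + 1 := by
    have h2 := Nat.le_ceil x
    have h3 : (⌈x⌉₊ : ℝ) ≤ φ n := by exact_mod_cast hn.trans (hφ.id_le n)
    linarith
  have h4 := (hsol (m (φ n))).normSq_le_of_eq_zero hd hx h1 (hzero (φ n))
  have h5 := (sq_nonneg _).trans h4
  have h6 := (le_div_iff₀ hc).1 h5
  simp only [Function.comp_apply]
  linarith

/-! ### Perturbation of the Weyl coefficient -/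

/-- The moment `∫₀^∞ t ^ a u(t)² dt`. -/
noncomputable def moment (a : ℝ) (u : ℝ → ℂ) : ℂ := ∫ t in Ioi (0 : ℝ), ((t ^ a : ℝ) : ℂ) * u t ^ 2

/-- The weighted mass `∫₀^∞ (1 + t ^ (2 α)) |u(t)|² dt`. -/
noncomputable def weightedMass (α : ℝ) (u : ℝ → ℂ) : ℝ :=
  ∫ t in Ioi (0 : ℝ), (1 + (t ^ α) ^ 2) * ‖u t‖ ^ 2

section

variable {α : ℝ} {u v : ℝ → ℂ}

theorem continuousOn_rpow_Ici {a : ℝ} (ha : 0 ≤ a) :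
    ContinuousOn (fun t : ℝ => ((t ^ a : ℝ) : ℂ)) (Ici 0) :=
  (Complex.continuous_ofReal.comp
    (continuous_id.rpow_const fun _ => Or.inr ha)).continuousOn

theorem ExpDecay.integrableOn_moment {a : ℝ} (ha : 0 ≤ a) (hu : ExpDecay u) (hc : Continuous u) :
    IntegrableOn (fun t : ℝ => ((t ^ a : ℝ) : ℂ) * u t ^ 2) (Ioi 0) := by
  refine ExpDecay.integrableOn ?_ ((continuousOn_rpow_Ici ha).mul (hc.pow 2).continuousOn)
  simpa [sq] using (hu.mul hu).rpow_mul a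

theorem ExpDecay.integrableOn_weightedMass (hα : 0 < α) (hu : ExpDecay u) (hc : Continuous u) :
    IntegrableOn (fun t : ℝ => (1 + (t ^ α) ^ 2) * ‖u t‖ ^ 2) (Ioi 0) := by
  have h2 : ExpDecay fun t => ((‖u t‖ : ℝ) : ℂ) * ((‖u t‖ : ℝ) : ℂ) := hu.norm.mul hu.norm
  have h := (h2.add ((h2.rpow_mul α).rpow_mul α)).integrableOn (by
    have := continuousOn_rpow_Ici hα.le
    have h3 : Continuous fun t => ((‖u t‖ : ℝ) : ℂ) := Complex.continuous_ofReal.comp hc.norm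
    exact ((h3.mul h3).continuousOn).add (this.mul (this.mul (h3.mul h3).continuousOn)))
  refine h.re.congr (ae_of_all _ fun t => ?_)
  simp only [RCLike.re_to_complex]
  norm_cast
  ring

/-- The Weyl coefficient is differentiable in the potential, with a quadratic remainder. The
derivative comes from the Wronskian of the two decaying solutions, and the remainder from the
dissipation of their difference. -/
theorem IsWeylSol.norm_weylCoeff_sub_le {P Q P₀ Q₀ : ℂ} {c : ℝ} {ω : ℂ} {u₀ v₀ : ℝ → ℂ}
    (hα : 0 < α) (h₀ : IsWeylSol (pot α P₀ Q₀) u₀ v₀) (h : IsWeylSol (pot α P Q) u v)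
    (hd : IsDissipative c ω (pot α P Q)) :
    ‖v 0 - v₀ 0 - ((P - P₀) * moment 0 u₀ + (Q - Q₀) * moment α u₀)‖ ≤
      4 / c * weightedMass α u₀ * (‖P - P₀‖ ^ 2 + ‖Q - Q₀‖ ^ 2) := by
  have hc := hd.pos
  set D : ℝ → ℂ := fun t => pot α P Q t - pot α P₀ Q₀ t with hDdef
  have hDc : Continuous D := (continuous_pot hα P Q).sub (continuous_pot hα P₀ Q₀)
  have hu0c := h₀.sol.continuous
  have hDnn : ∀ t, 0 ≤ t → D t = (P - P₀) + (Q - Q₀) * ((t ^ α : ℝ) : ℂ) := fun t ht => by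
    simp only [D, pot_of_nonneg _ _ ht]; ring
  -- the difference of the solutions, which vanishes at `0`, and its flux
  set w : ℝ → ℂ := fun t => u t - u₀ t with hw
  set w' : ℝ → ℂ := fun t => v t - v₀ t with hw'
  set F := flux ω w w' with hF
  set W : ℝ → ℂ := fun t => u₀ t * v t - v₀ t * u t with hWdef
  set N : ℝ → ℝ := fun t => ‖D t * u₀ t‖ ^ 2 with hN
  have hNc : Continuous N := (hDc.mul hu0c).norm.pow 2
  have hF' : ∀ t, HasDerivAt F (ω.im * ‖w' t‖ ^ 2 - (ω * pot α P Q t).im * ‖w t‖ ^ 2 +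
      (ω * (starRingEnd ℂ) (w t) * (-(D t * u₀ t))).im) t := fun t =>
    FractionalReflector.hasDerivAt_flux ((h.sol.hu t).sub (h₀.sol.hu t))
      (((h.sol.hv t).sub (h₀.sol.hv t)).congr_deriv (by simp only [w, D]; ring))
  have hW' : ∀ t, HasDerivAt W (-(D t * u₀ t * u t)) t := fun t =>
    (((h₀.sol.hu t).mul (h.sol.hv t)).sub ((h₀.sol.hv t).mul (h.sol.hu t))).congr_deriv
      (by simp only [D]; ring)
  have hint : ∀ {f : ℝ → ℂ}, Continuous f → ∀ t,
      HasDerivAt (fun T => ∫ s in (0 : ℝ)..T, f s) (f t) t := fun hf t =>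
    intervalIntegral.integral_hasDerivAt_right (hf.intervalIntegrable _ _)
      hf.stronglyMeasurable.stronglyMeasurableAtFilter hf.continuousAt
  have hintN : ∀ t, HasDerivAt (fun T => ∫ s in (0 : ℝ)..T, N s) (N t) t := fun t =>
    intervalIntegral.integral_hasDerivAt_right (hNc.intervalIntegrable _ _)
      hNc.stronglyMeasurable.stronglyMeasurableAtFilter hNc.continuousAt
  have hDuc : Continuous fun t => D t * u₀ t ^ 2 := hDc.mul (hu0c.pow 2)
  -- the left side has derivative `D u₀ w`, and `|w|²` is absorbed by the growth of the flux of `w`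
  have hfin : ∀ T, 0 ≤ T → ‖v 0 - v₀ 0 - W T - ∫ t in (0 : ℝ)..T, D t * u₀ t ^ 2‖ ≤
      F T / 2 + 2 / c * ∫ t in (0 : ℝ)..T, N t := by
    intro T hT
    refine image_norm_le_of_norm_deriv_right_le_deriv_boundary
      (f := fun T => v 0 - v₀ 0 - W T - ∫ t in (0 : ℝ)..T, D t * u₀ t ^ 2)
      (f' := fun t => D t * u₀ t * w t) (a := 0) (b := T) (fun t _ => ?_) (fun t _ => ?_) ?_
      (fun t => ((hF' t).div_const 2).add ((hintN t).const_mul (2 / c)))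
      (fun t ht => ?_) (right_mem_Icc.2 hT)
    · exact (((hW' t).const_sub _).sub (hint hDuc t)).continuousAt.continuousWithinAt
    · exact ((((hW' t).const_sub _).sub (hint hDuc t)).congr_deriv
        (by simp only [w]; ring)).hasDerivWithinAt
    · simp [W, F, flux, w, h.data, h₀.data]
    · have h1 := hd.le_deriv_flux ht.1 (w t) (w' t)
      have h2 : -(2 * (‖w t‖ * ‖D t * u₀ t‖)) ≤
          (ω * (starRingEnd ℂ) (w t) * (-(D t * u₀ t))).im := by
        refine neg_le_of_abs_le ((Complex.abs_im_le_norm _).trans ?_)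
        rw [norm_mul, norm_mul, norm_neg, RCLike.norm_conj, mul_assoc]
        gcongr
        exact hd.norm_le
      rw [norm_mul]
      simp only [N]
      set a := ‖w t‖
      set b := ‖D t * u₀ t‖
      have h3 : 2 * (a * b) ≤ c / 2 * a ^ 2 + 2 / c * b ^ 2 := by
        have h4 : c / 2 * a ^ 2 + 2 / c * b ^ 2 - 2 * (a * b) =
            (c * a - 2 * b) ^ 2 / (2 * c) := by field_simp; ring
        have h5 : 0 ≤ (c * a - 2 * b) ^ 2 / (2 * c) := by positivity
        linarith
      have h6 : 0 ≤ c * ‖w' t‖ ^ 2 := by positivity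
      linarith
  -- let `T → ∞`
  have hwd : ExpDecay w := h.decay.sub h₀.decay
  have hwd' : ExpDecay w' := h.decay_deriv.sub h₀.decay_deriv
  have hWlim : Tendsto W atTop (𝓝 0) :=
    ((h₀.decay.mul h.decay_deriv).sub (h₀.decay_deriv.mul h.decay)).tendsto
  have hFlim : Tendsto F atTop (𝓝 0) := by
    have h1 := (((hwd.conj.mul hwd').const_mul ω).tendsto)
    have h2 := (Complex.continuous_im.tendsto 0).comp h1
    rw [Complex.zero_im] at h2
    exact h2.congr fun t => by simp only [Function.comp_apply, F, flux, mul_assoc]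
  have hsq : EqOn (fun t => D t * u₀ t ^ 2)
      (fun t => (P - P₀) * (((t ^ (0 : ℝ) : ℝ) : ℂ) * u₀ t ^ 2) +
      (Q - Q₀) * (((t ^ α : ℝ) : ℂ) * u₀ t ^ 2)) (Ioi 0) := fun t ht => by
    simp only [hDnn t (le_of_lt ht), Real.rpow_zero]; push_cast; ring
  have hI0 := (h₀.decay.integrableOn_moment le_rfl hu0c).const_mul (P - P₀)
  have hIα := (h₀.decay.integrableOn_moment hα.le hu0c).const_mul (Q - Q₀)
  have hDint : IntegrableOn (fun t => D t * u₀ t ^ 2) (Ioi 0) :=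
    IntegrableOn.congr_fun (hI0.add hIα) (fun t ht => (hsq ht).symm) measurableSet_Ioi
  have hDval : ∫ t in Ioi (0 : ℝ), D t * u₀ t ^ 2 =
      (P - P₀) * moment 0 u₀ + (Q - Q₀) * moment α u₀ := by
    rw [setIntegral_congr_fun measurableSet_Ioi hsq, integral_add hI0 hIα,
      integral_const_mul, integral_const_mul]
    rfl
  have hNle : ∀ t ∈ Ioi (0 : ℝ), N t ≤ 2 * (‖P - P₀‖ ^ 2 + ‖Q - Q₀‖ ^ 2) *
      ((1 + (t ^ α) ^ 2) * ‖u₀ t‖ ^ 2) := fun t ht => by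
    have h1 : ‖D t‖ ≤ ‖P - P₀‖ + ‖Q - Q₀‖ * t ^ α := by
      rw [hDnn t (le_of_lt ht)]
      refine (norm_add_le _ _).trans_eq ?_
      rw [norm_mul, Complex.norm_real, Real.norm_eq_abs,
        abs_of_nonneg (Real.rpow_nonneg (le_of_lt ht) _)]
    have h2 : ‖D t‖ ^ 2 ≤ 2 * (‖P - P₀‖ ^ 2 + ‖Q - Q₀‖ ^ 2) * (1 + (t ^ α) ^ 2) := by
      have h3 := pow_le_pow_left₀ (norm_nonneg _) h1 2
      nlinarith [sq_nonneg (‖P - P₀‖ - ‖Q - Q₀‖ * t ^ α), sq_nonneg (‖P - P₀‖ * t ^ α),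
        sq_nonneg (‖Q - Q₀‖)]
    simp only [N, norm_mul, mul_pow]
    rw [← mul_assoc]
    gcongr
  have hmass := (h₀.decay.integrableOn_weightedMass hα hu0c).const_mul
    (2 * (‖P - P₀‖ ^ 2 + ‖Q - Q₀‖ ^ 2))
  have hNint : IntegrableOn N (Ioi 0) :=
    Integrable.mono' hmass hNc.aestronglyMeasurable
      ((ae_restrict_iff' measurableSet_Ioi).2 (ae_of_all _ fun t ht => by
        rw [Real.norm_eq_abs, abs_of_nonneg (by positivity)]
        exact hNle t ht))
  have hNval : ∫ t in Ioi (0 : ℝ), N t ≤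
      2 * (‖P - P₀‖ ^ 2 + ‖Q - Q₀‖ ^ 2) * weightedMass α u₀ := by
    rw [weightedMass, ← integral_const_mul]
    exact setIntegral_mono_on hNint hmass measurableSet_Ioi hNle
  have hlim1 := ((tendsto_const_nhds (x := v 0 - v₀ 0)).sub hWlim).sub
    (intervalIntegral_tendsto_integral_Ioi 0 hDint tendsto_id)
  have hlim2 := (hFlim.div_const 2).add
    ((intervalIntegral_tendsto_integral_Ioi 0 hNint tendsto_id).const_mul (2 / c))
  have hle := le_of_tendsto_of_tendsto hlim1.norm hlim2
    ((eventually_ge_atTop 0).mono fun T hT => hfin T hT)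
  rw [hDval, sub_zero, zero_div, zero_add] at hle
  refine hle.trans ((mul_le_mul_of_nonneg_left hNval (by positivity)).trans_eq ?_)
  ring

/-- The virial identity for the decaying solution: integrate the derivative of
`t (u'² + V u²) - u u'`. -/
theorem IsWeylSol.virial {P Q : ℂ} (hα : 0 < α) (h : IsWeylSol (pot α P Q) u v) :
    2 * P * moment 0 u + (α + 2) * Q * moment α u = v 0 := by
  have hu := h.sol.hu
  have hv := h.sol.hv
  have huc := h.sol.continuous
  have hvc := h.sol.continuous_deriv
  have hI0 := (h.decay.integrableOn_moment le_rfl huc).const_mul (2 * P)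
  have hIα := (h.decay.integrableOn_moment hα.le huc).const_mul ((α + 2) * Q)
  have hderiv : ∀ t ∈ Ioi (0 : ℝ), HasDerivAt
      (fun t : ℝ => (t : ℂ) * v t ^ 2 + (t : ℂ) * pot α P Q t * u t ^ 2 - u t * v t)
      (2 * P * (((t ^ (0 : ℝ) : ℝ) : ℂ) * u t ^ 2) +
        (α + 2) * Q * (((t ^ α : ℝ) : ℂ) * u t ^ 2)) t := by
    intro t ht
    have ht0 : (0 : ℝ) < t := ht
    have hid : HasDerivAt (fun t : ℝ => (t : ℂ)) 1 t := Complex.ofRealCLM.hasDerivAt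
    have hpot : HasDerivAt (pot α P Q) (Q * ((α * t ^ (α - 1) : ℝ) : ℂ)) t := by
      have h1 := (((Real.hasDerivAt_rpow_const (p := α) (Or.inl ht0.ne')).ofReal_comp).const_mul
        Q).const_add P
      refine h1.congr_of_eventuallyEq ?_
      filter_upwards [Ioi_mem_nhds ht0] with s hs
      exact pot_of_nonneg P Q (le_of_lt hs)
    refine ((((hid.mul ((hv t).pow 2)).add ((hid.mul hpot).mul ((hu t).pow 2)))).sub
      ((hu t).mul (hv t))).congr_deriv ?_
    have h2 : ((t : ℂ)) * ((α * t ^ (α - 1) : ℝ) : ℂ) = α * ((t ^ α : ℝ) : ℂ) := by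
      rw [Real.rpow_sub_one ht0.ne']
      push_cast
      field_simp [Complex.ofReal_ne_zero.2 ht0.ne']
    simp only [Pi.mul_apply, Pi.pow_apply, pot_of_nonneg P Q ht0.le, Real.rpow_zero]
    push_cast at h2 ⊢
    linear_combination Q * u t ^ 2 * h2
  have hcont : ContinuousWithinAt
      (fun t : ℝ => (t : ℂ) * v t ^ 2 + (t : ℂ) * pot α P Q t * u t ^ 2 - u t * v t)
      (Ici 0) 0 := by
    have := continuous_pot hα P Q
    exact Continuous.continuousWithinAt (by fun_prop)
  have hlim : Tendsto
      (fun t : ℝ => (t : ℂ) * v t ^ 2 + (t : ℂ) * pot α P Q t * u t ^ 2 - u t * v t)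
      atTop (𝓝 0) := by
    have hid : ∀ {f : ℝ → ℂ}, ExpDecay f → ExpDecay fun t => (t : ℂ) * f t := fun hf => by
      simpa using hf.rpow_mul 1
    have huu := h.decay.mul h.decay
    refine ExpDecay.tendsto (ExpDecay.sub (ExpDecay.add ?_ ?_) (h.decay.mul h.decay_deriv))
    · simpa [sq] using hid (h.decay_deriv.mul h.decay_deriv)
    · refine (hid ((huu.const_mul P).add ((huu.rpow_mul α).const_mul Q))).mono
        (EventuallyEq.isBigO ?_)
      filter_upwards [eventually_ge_atTop 0] with t ht
      rw [pot_of_nonneg P Q ht]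
      ring
  have := integral_Ioi_of_hasDerivAt_of_tendsto hcont hderiv (hI0.add hIα) hlim
  rw [integral_add hI0 hIα, integral_const_mul, integral_const_mul] at this
  simp only [Complex.ofReal_zero, zero_mul, h.data, one_mul, zero_add, zero_sub, sub_neg_eq_add,
    add_zero] at this
  exact this

/-- Complex scaling: turning the half line by the angle `-s₁` turns the Weyl coefficient by `-s₁`.
If `u(x)` solves `u'' + (P + Q x ^ α) u = 0`, then `u(exp (-i s) t)` formally solves the equation
with the turned coefficients below. No solution is continued to complex `x` here: the turned
coefficients define a Weyl coefficient `M s`, which solves `M' = -i M`. -/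
theorem IsWeylCoeff.rotate {P Q ω m : ℂ} {c s₁ : ℝ} (hα : 0 < α) (hs₁ : 0 ≤ s₁)
    (hd : ∀ s ∈ Icc 0 s₁, IsDissipative c ω
      (pot α (P * Complex.exp (-(2 * s) * Complex.I)) (Q * Complex.exp (-((α + 2) * s) * Complex.I))))
    (hm : IsWeylCoeff (pot α P Q) m) :
    IsWeylCoeff (pot α (P * Complex.exp (-(2 * s₁) * Complex.I))
      (Q * Complex.exp (-((α + 2) * s₁) * Complex.I))) (Complex.exp (-s₁ * Complex.I) * m) := by
  set p : ℝ → ℂ := fun s => P * Complex.exp (-(2 * s) * Complex.I) with hp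
  set q : ℝ → ℂ := fun s => Q * Complex.exp (-((α + 2) * s) * Complex.I) with hq
  choose! M hM using fun s hs => exists_isWeylCoeff hα (hd s hs)
  have hexp : ∀ (a : ℂ) (s : ℝ), HasDerivAt (fun s : ℝ => Complex.exp (-(a * s) * Complex.I))
      (Complex.exp (-(a * s) * Complex.I) * (-a * Complex.I)) s := fun a s => by
    have hid : HasDerivAt (fun t : ℝ => (t : ℂ)) 1 s := Complex.ofRealCLM.hasDerivAt
    simpa using (((hid.const_mul a).neg).mul_const Complex.I).cexp
  have hp' : ∀ s, HasDerivAt p (p s * (-2 * Complex.I)) s := fun s =>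
    ((hexp 2 s).const_mul P).congr_deriv (by simp only [p]; ring)
  have hq' : ∀ s, HasDerivAt q (q s * (-(α + 2) * Complex.I)) s := fun s =>
    ((hexp (α + 2) s).const_mul Q).congr_deriv (by simp only [q]; ring)
  -- the first variation of `M` is evaluated by the virial identity
  have hM' : ∀ s ∈ Icc 0 s₁, HasDerivWithinAt M (-Complex.I * M s) (Icc 0 s₁) s := by
    intro s hs
    obtain ⟨u₀, v₀, h₀, hm₀⟩ := hM s hs
    set Φ : ℝ → ℂ := fun r => p r * moment 0 u₀ + q r * moment α u₀
    have hΦ : HasDerivAt Φ (-Complex.I * M s) s := by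
      refine (((hp' s).mul_const _).add ((hq' s).mul_const _)).congr_deriv ?_
      rw [← hm₀, ← h₀.virial hα]
      simp only [p, q]
      ring
    have hrem : HasDerivWithinAt (fun r => M r - Φ r) 0 (Icc 0 s₁) s := by
      rw [hasDerivWithinAt_iff_isLittleO]
      have hO : (fun r => M r - Φ r - (M s - Φ s) - (r - s) • (0 : ℂ)) =O[𝓝[Icc 0 s₁] s]
          fun r => ‖p r - p s‖ ^ 2 + ‖q r - q s‖ ^ 2 := by
        refine IsBigO.of_bound (4 / c * weightedMass α u₀) ?_
        filter_upwards [self_mem_nhdsWithin] with r hr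
        obtain ⟨u, v, h, hmr⟩ := hM r hr
        have := h₀.norm_weylCoeff_sub_le hα h (hd r hr)
        rw [Real.norm_eq_abs, abs_of_nonneg (by positivity)]
        refine le_trans (le_of_eq ?_) this
        rw [hmr, hm₀]
        congr 1
        simp only [Φ, p, q, smul_zero]
        ring
      refine hO.trans_isLittleO (IsLittleO.mono ?_ nhdsWithin_le_nhds)
      have h1 : ∀ {f : ℝ → ℂ} {f' : ℂ}, HasDerivAt f f' s →
          (fun r => ‖f r - f s‖ ^ 2) =o[𝓝 s] fun r => r - s := fun hf =>
        ((hf.isBigO_sub.norm_norm.pow 2).trans_isLittleO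
          (isLittleO_pow_sub_sub s one_lt_two))
      exact (h1 (hp' s)).add (h1 (hq' s))
    exact ((hrem.add hΦ.hasDerivWithinAt).congr_deriv (zero_add _)).congr
      (fun r _ => by simp) (by simp)
  set f : ℝ → ℂ := fun s => Complex.exp (-(-1 * s) * Complex.I) * M s
  have hf' : ∀ s ∈ Icc 0 s₁, HasDerivWithinAt f 0 (Icc 0 s₁) s := fun s hs =>
    (((hexp (-1) s).hasDerivWithinAt).mul (hM' s hs)).congr_deriv (by ring)
  have hconst := constant_of_has_deriv_right_zero
    (fun s hs => (hf' s hs).continuousWithinAt)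
    (fun s hs => (hf' s (Ico_subset_Icc_self hs)).mono_of_mem_nhdsWithin
      (Icc_mem_nhdsGE_of_mem hs)) s₁ (right_mem_Icc.2 hs₁)
  have h0 : (0 : ℝ) ∈ Icc 0 s₁ := left_mem_Icc.2 hs₁
  have hp0 : p 0 = P := by simp [p]
  have hq0 : q 0 = Q := by simp [q]
  have hm0 : M 0 = m := by
    have h1 := hd 0 h0
    have h2 := hM 0 h0
    change IsDissipative c ω (pot α (p 0) (q 0)) at h1
    change IsWeylCoeff (pot α (p 0) (q 0)) (M 0) at h2
    rw [hp0, hq0] at h1 h2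
    exact hm.unique h1 h2
  have hM1 : M s₁ = Complex.exp (-s₁ * Complex.I) * m := by
    simp only [f, Complex.ofReal_zero, zero_mul, Complex.exp_zero, one_mul,
      neg_mul, neg_neg, hm0] at hconst
    rw [← hconst, ← mul_assoc, ← Complex.exp_add]
    simp
  exact hM1 ▸ hM s₁ (right_mem_Icc.2 hs₁)

end

/-! ### A Laplace transform -/

theorem integrableOn_rpow_mul_exp {a b : ℝ} (ha : -1 < a) (hb : 0 < b) :
    IntegrableOn (fun t : ℝ => t ^ a * Real.exp (-b * t)) (Ioi 0) := by
  simpa using integrableOn_rpow_mul_exp_neg_mul_rpow ha one_pos hb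

/-- Euler's integral for a complex rate, by analytic continuation from positive rates. -/
theorem integral_rpow_mul_cexp {α : ℝ} (hα : 0 < α) {r : ℂ} (hr : 0 < r.re) :
    ∫ t in Ioi (0 : ℝ), ((t ^ α : ℝ) : ℂ) * Complex.exp (-(r * t)) =
      (1 / r) ^ ((α + 1 : ℝ) : ℂ) * Real.Gamma (α + 1) := by
  set F : ℂ → ℂ := fun r => ∫ t in Ioi (0 : ℝ), ((t ^ α : ℝ) : ℂ) * Complex.exp (-(r * t))
  set G : ℂ → ℂ := fun r => (1 / r) ^ ((α + 1 : ℝ) : ℂ) * Real.Gamma (α + 1)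
  set H : Set ℂ := {z | 0 < z.re}
  have hopen : IsOpen H := isOpen_lt continuous_const Complex.continuous_re
  have hmeas : ∀ (z : ℂ) (a : ℝ), 0 ≤ a → AEStronglyMeasurable
      (fun t : ℝ => ((t ^ a : ℝ) : ℂ) * Complex.exp (-(z * t))) (volume.restrict (Ioi 0)) :=
    fun z a ha => by
      have : Continuous fun t : ℝ => ((t ^ a : ℝ) : ℂ) :=
        Complex.continuous_ofReal.comp (continuous_id.rpow_const fun _ => Or.inr ha)
      exact (by fun_prop : Continuous _).aestronglyMeasurable
  have hnorm : ∀ (z : ℂ) (a t : ℝ), 0 < t →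
      ‖((t ^ a : ℝ) : ℂ) * Complex.exp (-(z * t))‖ = t ^ a * Real.exp (-z.re * t) :=
    fun z a t ht => by
      rw [norm_mul, Complex.norm_real, Complex.norm_exp, Real.norm_eq_abs,
        abs_of_nonneg (Real.rpow_nonneg ht.le a)]
      simp
  have hF : DifferentiableOn ℂ F H := fun z hz => by
    have hz' : 0 < z.re := hz
    refine (hasDerivAt_integral_of_dominated_loc_of_deriv_le (𝕜 := ℂ)
      (μ := volume.restrict (Ioi 0)) (x₀ := z)
      (F := fun (r : ℂ) (t : ℝ) => ((t ^ α : ℝ) : ℂ) * Complex.exp (-(r * t)))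
      (F' := fun (r : ℂ) (t : ℝ) => ((t ^ α : ℝ) : ℂ) * (Complex.exp (-(r * t)) * (-t)))
      (bound := fun t : ℝ => t ^ (α + 1) * Real.exp (-(z.re / 2) * t))
      (Metric.ball_mem_nhds z (half_pos hz')) (Eventually.of_forall fun r => hmeas r α hα.le)
      ?_ ?_ ?_ (integrableOn_rpow_mul_exp (by linarith) (half_pos hz'))
      ?_).2.differentiableAt.differentiableWithinAt
    · refine (integrableOn_rpow_mul_exp (by linarith : -1 < α) hz').mono' (hmeas z α hα.le) ?_
      exact (ae_restrict_iff' measurableSet_Ioi).2 (ae_of_all _ fun t ht => (hnorm z α t ht).le)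
    · have : Continuous fun t : ℝ => ((t ^ α : ℝ) : ℂ) :=
        Complex.continuous_ofReal.comp (continuous_id.rpow_const fun _ => Or.inr hα.le)
      exact (by fun_prop : Continuous _).aestronglyMeasurable
    · refine (ae_restrict_iff' measurableSet_Ioi).2 (ae_of_all _ fun t ht r hr => ?_)
      have ht0 : (0 : ℝ) < t := ht
      have h1 : z.re / 2 ≤ r.re := by
        have h2 := (Complex.abs_re_le_norm (r - z)).trans (mem_ball_iff_norm.1 hr).le
        rw [Complex.sub_re] at h2
        linarith [(abs_le.1 h2).1]
      rw [← mul_assoc, norm_mul, hnorm r α t ht0, norm_neg, Complex.norm_real, Real.norm_eq_abs,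
        abs_of_pos ht0, Real.rpow_add_one ht0.ne']
      have h3 : Real.exp (-r.re * t) ≤ Real.exp (-(z.re / 2) * t) := by
        gcongr
      have h4 : 0 ≤ t ^ α * t := by positivity
      nlinarith
    · refine ae_of_all _ fun t r _ => ?_
      have h1 : HasDerivAt (fun r : ℂ => -(r * (t : ℂ))) (-(t : ℂ)) r :=
        ((hasDerivAt_id r).mul_const (t : ℂ)).neg.congr_deriv (by simp)
      exact (h1.cexp).const_mul _
  have hG : DifferentiableOn ℂ G H := fun z hz => by
    have hz' : 0 < z.re := hz
    have hz0 : z ≠ 0 := fun h => by simp [h] at hz'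
    have hslit : 1 / z ∈ Complex.slitPlane := by
      refine Or.inl ?_
      rw [one_div, Complex.inv_re]
      exact div_pos hz' (Complex.normSq_pos.2 hz0)
    have h1 : DifferentiableAt ℂ (fun z : ℂ => 1 / z) z :=
      (differentiableAt_const 1).div differentiableAt_id hz0
    exact ((h1.cpow_const hslit).mul_const _).differentiableWithinAt
  have hreal : ∀ x : ℝ, 0 < x → F x = G x := fun x hx => by
    have h1 := Complex.integral_cpow_mul_exp_neg_mul_Ioi (a := ((α + 1 : ℝ) : ℂ)) (r := x)
      (by simp; linarith) hx
    rw [Complex.Gamma_ofReal] at h1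
    refine Eq.trans (setIntegral_congr_fun measurableSet_Ioi fun t ht => ?_) h1
    have : (((α + 1 : ℝ) : ℂ) - 1) = (α : ℂ) := by push_cast; ring
    simp only [this, Complex.ofReal_cpow (le_of_lt ht)]
  have hfreq : ∃ᶠ z in 𝓝[≠] (1 : ℂ), F z = G z := by
    have ht : Tendsto (fun x : ℝ => (x : ℂ)) (𝓝[>] 1) (𝓝[≠] (1 : ℂ)) := by
      refine tendsto_nhdsWithin_of_tendsto_nhds_of_eventually_within _ ?_ ?_
      · have := (Complex.continuous_ofReal.tendsto 1).mono_left
          (nhdsWithin_le_nhds (s := Ioi (1 : ℝ)))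
        simpa using this
      · filter_upwards [self_mem_nhdsWithin] with x hx
        have : (1 : ℝ) < x := hx
        simpa using this.ne'
    refine ht.frequently (Eventually.frequently ?_)
    filter_upwards [self_mem_nhdsWithin] with x hx
    exact hreal x (one_pos.trans hx)
  exact AnalyticOnNhd.eqOn_of_preconnected_of_frequently_eq (hF.analyticOnNhd hopen)
    (hG.analyticOnNhd hopen) (convex_halfSpace_re_gt 0).isPreconnected
    (show (0 : ℝ) < (1 : ℂ).re by simp) hfreq hr

/-! ### The Weyl coefficient of the model equation -/

/-- The complexified wave number `1 + i σ`. -/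
noncomputable def waveNumber (σ : ℝ) : ℂ := 1 + Complex.I * σ

@[simp] theorem waveNumber_re (σ : ℝ) : (waveNumber σ).re = 1 := by simp [waveNumber]

@[simp] theorem waveNumber_im (σ : ℝ) : (waveNumber σ).im = σ := by simp [waveNumber]

@[simp] theorem waveNumber_zero : waveNumber 0 = 1 := by simp [waveNumber]

theorem waveNumber_ne_zero (σ : ℝ) : waveNumber σ ≠ 0 := fun h => by
  have := waveNumber_re σ
  simp [h] at this

theorem normSq_waveNumber (σ : ℝ) : Complex.normSq (waveNumber σ) = 1 + σ ^ 2 := by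
  rw [Complex.normSq_apply]; simp; ring

theorem one_le_norm_waveNumber (σ : ℝ) : 1 ≤ ‖waveNumber σ‖ := by
  simpa using Complex.abs_re_le_norm (waveNumber σ)

theorem norm_waveNumber_inv_le (σ : ℝ) : ‖(waveNumber σ)⁻¹‖ ≤ 1 := by
  rw [norm_inv]
  exact inv_le_one_of_one_le₀ (one_le_norm_waveNumber σ)

/-- The potential `(1 + i σ)² c⁻²` of the model equation. -/
noncomputable def modelPot (α θ σ : ℝ) : ℝ → ℂ :=
  pot α (waveNumber σ ^ 2) (waveNumber σ ^ 2 * θ)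

/-- The angle of the complex scaling. It turns `x ^ α` times the square of the scaling factor into
`-i x ^ α`, so that the undamped equation becomes dissipative. -/
noncomputable def scalingAngle (α : ℝ) : ℝ := Real.pi / (2 * (α + 2))

section

variable {α : ℝ}

theorem scalingAngle_pos (hα : 0 < α) : 0 < scalingAngle α := by
  unfold scalingAngle; positivity

theorem mul_scalingAngle (hα : 0 < α) : (α + 2) * scalingAngle α = Real.pi / 2 := by
  unfold scalingAngle; field_simp

theorem scalingAngle_le (hα : 0 < α) : scalingAngle α ≤ Real.pi / 4 := by
  have h1 := mul_scalingAngle hα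
  have h2 := mul_pos hα (scalingAngle_pos hα)
  linarith

theorem sin_scalingAngle_pos (hα : 0 < α) : 0 < Real.sin (scalingAngle α) :=
  Real.sin_pos_of_pos_of_lt_pi (scalingAngle_pos hα)
    (by linarith [scalingAngle_le hα, Real.pi_pos])

theorem sin_le_cos_scalingAngle (hα : 0 < α) :
    Real.sin (scalingAngle α) ≤ Real.cos (scalingAngle α) := by
  have h1 := scalingAngle_le hα
  rw [← Real.cos_pi_div_two_sub]
  exact Real.cos_le_cos_of_nonneg_of_le_pi (scalingAngle_pos hα).le
    (by linarith [scalingAngle_pos hα, Real.pi_pos]) (by linarith)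

theorem exp_mul_scalingAngle (hα : 0 < α) :
    Complex.exp (-((α + 2) * scalingAngle α) * Complex.I) = -Complex.I := by
  have h := mul_scalingAngle hα
  have h2 : ((α : ℂ) + 2) * (scalingAngle α : ℂ) = Real.pi / 2 := by exact_mod_cast h
  rw [h2, neg_mul, Complex.exp_neg, Complex.exp_pi_div_two_mul_I, Complex.inv_I]

/-- For `σ < 0` the model equation is dissipative, and remains so at all intermediate angles of the
complex scaling. For `s ≠ 0` the bound `-1 ≤ σ` keeps the imaginary parts negative. -/
theorem isDissipative_rotated {θ σ s : ℝ} (hα : 0 < α) (hθ : 0 ≤ θ) (hσ : σ < 0)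
    (hs : s = 0 ∨ -1 ≤ σ ∧ s ∈ Icc 0 (scalingAngle α)) :
    IsDissipative (-σ / (1 + σ ^ 2)) (waveNumber σ)⁻¹
      (pot α (waveNumber σ ^ 2 * Complex.exp (-(2 * s) * Complex.I))
        (waveNumber σ ^ 2 * θ * Complex.exp (-((α + 2) * s) * Complex.I))) := by
  have hne := waveNumber_ne_zero σ
  have hle : -σ / (1 + σ ^ 2) ≤ -σ := div_le_self (by linarith) (by nlinarith [sq_nonneg σ])
  have him : ∀ p : ℝ, p = 0 ∨ -1 ≤ σ ∧ p ∈ Icc 0 (Real.pi / 2) →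
      (waveNumber σ * Complex.exp (-p * Complex.I)).im ≤ σ := fun p hp => by
    have h1 : Complex.exp (-p * Complex.I) = Real.cos p - Real.sin p * Complex.I := by
      rw [← Complex.ofReal_neg, Complex.exp_mul_I, ← Complex.ofReal_cos, ← Complex.ofReal_sin,
        Real.cos_neg, Real.sin_neg]
      push_cast; ring
    have h2 : (waveNumber σ * Complex.exp (-p * Complex.I)).im =
        σ * Real.cos p - Real.sin p := by
      rw [h1, Complex.mul_im]; simp [-Complex.ofReal_cos, -Complex.ofReal_sin]; ring
    rw [h2]
    rcases hp with rfl | ⟨hσ1, hp⟩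
    · simp
    · have h3 := Real.cos_nonneg_of_mem_Icc (x := p)
        ⟨by linarith [hp.1, Real.pi_pos], hp.2⟩
      have h4 := Real.sin_nonneg_of_nonneg_of_le_pi hp.1 (by linarith [hp.2, Real.pi_pos])
      have h5 : 1 ≤ Real.cos p + Real.sin p := by
        nlinarith [Real.sin_sq_add_cos_sq p, mul_nonneg h3 h4]
      nlinarith
  refine isDissipative_pot (div_pos (by linarith) (by positivity))
    ((norm_waveNumber_inv_le σ).trans one_le_two) ?_ ?_ ?_
  · rw [Complex.inv_im, normSq_waveNumber, waveNumber_im]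
  · have h1 : (waveNumber σ)⁻¹ * (waveNumber σ ^ 2 * Complex.exp (-(2 * s) * Complex.I)) =
        waveNumber σ * Complex.exp (-((2 * s : ℝ) : ℂ) * Complex.I) := by
      push_cast; field_simp
    rw [h1]
    refine (him _ ?_).trans (by linarith)
    rcases hs with rfl | ⟨h, hs⟩
    · simp
    · exact Or.inr ⟨h, by linarith [hs.1], by linarith [hs.2, scalingAngle_le hα]⟩
  · have h1 : (waveNumber σ)⁻¹ * (waveNumber σ ^ 2 * θ *
        Complex.exp (-((α + 2) * s) * Complex.I)) =
        waveNumber σ * Complex.exp (-(((α + 2) * s : ℝ) : ℂ) * Complex.I) * θ := by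
      push_cast; field_simp
    rw [h1, Complex.im_mul_ofReal]
    refine mul_nonpos_of_nonpos_of_nonneg ((him _ ?_).trans hσ.le) hθ
    rcases hs with rfl | ⟨h, hs⟩
    · simp
    · refine Or.inr ⟨h, by have := hs.1; positivity, ?_⟩
      rw [← mul_scalingAngle hα]
      have := hs.2
      gcongr

theorem isDissipative_modelPot {θ σ : ℝ} (hα : 0 < α) (hθ : 0 ≤ θ) (hσ : σ < 0) :
    IsDissipative (-σ / (1 + σ ^ 2)) (waveNumber σ)⁻¹ (modelPot α θ σ) := by
  simpa [modelPot] using isDissipative_rotated (s := 0) hα hθ hσ (Or.inl rfl)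

/-- The potential of the model equation on the half line turned by the angle
`-scalingAngle α`. -/
noncomputable def scaledPot (α θ σ : ℝ) : ℝ → ℂ :=
  pot α (waveNumber σ ^ 2 * Complex.exp (-(2 * scalingAngle α) * Complex.I))
    (waveNumber σ ^ 2 * θ * -Complex.I)

/-- After the scaling the dissipation is uniform as `σ → 0`. -/
theorem isDissipative_scaledPot {θ σ : ℝ} (hα : 0 < α) (hθ : 0 ≤ θ) (hσ : σ ∈ Icc (-1) 0) :
    IsDissipative (Real.sin (scalingAngle α) / 4)
      ((waveNumber σ ^ 2)⁻¹ * Complex.exp (scalingAngle α * Complex.I)) (scaledPot α θ σ) := by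
  have hne := waveNumber_ne_zero σ
  have hs := sin_scalingAngle_pos hα
  have hsc := sin_le_cos_scalingAngle hα
  set s := scalingAngle α
  have hexp : Complex.exp (s * Complex.I) = Real.cos s + Real.sin s * Complex.I := by
    rw [Complex.exp_mul_I, ← Complex.ofReal_cos, ← Complex.ofReal_sin]
  refine isDissipative_pot (by positivity) ?_ ?_ ?_ ?_
  · rw [norm_mul, Complex.norm_exp_ofReal_mul_I, mul_one, norm_inv, norm_pow]
    exact (inv_le_one_of_one_le₀ (one_le_pow₀ (one_le_norm_waveNumber σ))).trans one_le_two
  · have h1 : ((waveNumber σ ^ 2)⁻¹ * Complex.exp (s * Complex.I)).im =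
        ((1 - σ ^ 2) * Real.sin s - 2 * σ * Real.cos s) / (1 + σ ^ 2) ^ 2 := by
      rw [hexp, Complex.mul_im, Complex.inv_re, Complex.inv_im, map_pow, normSq_waveNumber]
      have h2 : (waveNumber σ ^ 2).re = 1 - σ ^ 2 := by rw [sq, Complex.mul_re]; simp; ring
      have h3 : (waveNumber σ ^ 2).im = 2 * σ := by rw [sq, Complex.mul_im]; simp; ring
      rw [h2, h3]
      simp [-Complex.ofReal_cos, -Complex.ofReal_sin]
      field_simp
      ring
    rw [h1, div_le_div_iff₀ (by norm_num) (by positivity)]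
    have h4 : σ ^ 2 ≤ 1 := by nlinarith [hσ.1, hσ.2]
    have h5 : (1 + σ ^ 2) ^ 2 ≤ 4 := by nlinarith [sq_nonneg σ]
    have h6 : 0 ≤ -σ * (Real.cos s - Real.sin s) :=
      mul_nonneg (by linarith [hσ.2]) (by linarith)
    have h7 : 0 ≤ -σ * (2 + σ) * Real.sin s :=
      mul_nonneg (mul_nonneg (by linarith [hσ.2]) (by linarith [hσ.1])) hs.le
    nlinarith
  · have h1 : (waveNumber σ ^ 2)⁻¹ * Complex.exp (s * Complex.I) *
        (waveNumber σ ^ 2 * Complex.exp (-(2 * s) * Complex.I)) =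
        Complex.exp (((-s : ℝ) : ℂ) * Complex.I) := by
      have h2 : Complex.exp (((-s : ℝ) : ℂ) * Complex.I) =
          Complex.exp (s * Complex.I) * Complex.exp (-(2 * s) * Complex.I) := by
        rw [← Complex.exp_add]; congr 1; push_cast; ring
      rw [h2]; field_simp
    rw [h1, Complex.exp_ofReal_mul_I_im, Real.sin_neg]
    linarith
  · have h1 : (waveNumber σ ^ 2)⁻¹ * Complex.exp (s * Complex.I) *
        (waveNumber σ ^ 2 * θ * -Complex.I) =
        (Complex.exp (s * Complex.I) * -Complex.I) * θ := by
      field_simp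
    rw [h1, Complex.im_mul_ofReal, hexp]
    refine mul_nonpos_of_nonpos_of_nonneg ?_ hθ
    rw [Complex.mul_im]
    simp [-Complex.ofReal_cos, -Complex.ofReal_sin]
    linarith

theorem exists_isWeylCoeff_scaledPot {θ : ℝ} (hα : 0 < α) (hθ : 0 ≤ θ) :
    ∃ m, IsWeylCoeff (scaledPot α θ 0) m :=
  exists_isWeylCoeff hα (isDissipative_scaledPot hα hθ ⟨by norm_num, le_rfl⟩)

open Classical in
/-- The logarithmic derivative at `0` of the transmitted wave, read off from the decaying solution
on the turned half line. For `0 < α` and `0 ≤ θ` the solution exists, and the value `0` of the other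
branch plays no role. -/
noncomputable def transmittedSlope (α θ : ℝ) : ℂ :=
  Complex.exp (scalingAngle α * Complex.I) *
    if h : ∃ m, IsWeylCoeff (scaledPot α θ 0) m then h.choose else 0

theorem exists_transmittedSlope_eq {θ : ℝ} (hα : 0 < α) (hθ : 0 ≤ θ) :
    ∃ m, IsWeylCoeff (scaledPot α θ 0) m ∧
      transmittedSlope α θ = Complex.exp (scalingAngle α * Complex.I) * m := by
  have h := exists_isWeylCoeff_scaledPot hα hθ
  exact ⟨_, h.choose_spec, by rw [transmittedSlope, dif_pos h]⟩

theorem IsWeylCoeff.scaled {θ σ : ℝ} {m : ℂ} (hα : 0 < α) (hθ : 0 ≤ θ) (hσ : σ < 0)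
    (hσ' : -1 ≤ σ) (hm : IsWeylCoeff (modelPot α θ σ) m) :
    IsWeylCoeff (scaledPot α θ σ) (Complex.exp (-scalingAngle α * Complex.I) * m) := by
  have := IsWeylCoeff.rotate hα (scalingAngle_pos hα).le
    (fun s hs => isDissipative_rotated hα hθ hσ (Or.inr ⟨hσ', hs⟩)) hm
  rwa [exp_mul_scalingAngle hα] at this

/-- Limiting absorption for the Weyl coefficient. -/
theorem exists_norm_weylCoeff_sub_le {θ : ℝ} (hα : 0 < α) (hθ : 0 ≤ θ) :
    ∃ K : ℝ, ∀ σ : ℝ, σ < 0 → -1 ≤ σ → ∀ m, IsWeylCoeff (modelPot α θ σ) m →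
      ‖m - transmittedSlope α θ‖ ≤ K * |σ| := by
  obtain ⟨m₀, ⟨u₀, v₀, h₀, hm₀⟩, hslope⟩ := exists_transmittedSlope_eq hα hθ
  set c := Real.sin (scalingAngle α) / 4
  have hc : 0 < c := by have := sin_scalingAngle_pos hα; positivity
  have hJ : 0 ≤ weightedMass α u₀ :=
    setIntegral_nonneg measurableSet_Ioi fun t _ => by positivity
  refine ⟨3 * ‖moment 0 u₀‖ + 3 * θ * ‖moment α u₀‖ +
    4 / c * weightedMass α u₀ * (9 + 9 * θ ^ 2), fun σ hσ hσ' m hm => ?_⟩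
  obtain ⟨u, v, h, hmv⟩ := hm.scaled hα hθ hσ hσ'
  have key := h₀.norm_weylCoeff_sub_le hα h (isDissipative_scaledPot hα hθ ⟨hσ', hσ.le⟩)
  set dP := waveNumber σ ^ 2 * Complex.exp (-(2 * scalingAngle α) * Complex.I) -
    waveNumber 0 ^ 2 * Complex.exp (-(2 * scalingAngle α) * Complex.I)
  set dQ := waveNumber σ ^ 2 * θ * -Complex.I - waveNumber 0 ^ 2 * θ * -Complex.I
  have hσa : |σ| = -σ := abs_of_neg hσ
  have hk : ‖waveNumber σ ^ 2 - waveNumber 0 ^ 2‖ ≤ 3 * |σ| := by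
    have h1 : waveNumber σ ^ 2 - waveNumber 0 ^ 2 = σ * (2 * Complex.I - σ) := by
      simp only [waveNumber, Complex.ofReal_zero]
      linear_combination (σ : ℂ) ^ 2 * Complex.I_sq
    rw [h1, norm_mul, Complex.norm_real, Real.norm_eq_abs, mul_comm]
    gcongr
    refine (norm_sub_le _ _).trans ?_
    simp
    linarith
  have hdP : ‖dP‖ ≤ 3 * |σ| := by
    have h1 : dP = (waveNumber σ ^ 2 - waveNumber 0 ^ 2) *
        Complex.exp (((-(2 * scalingAngle α) : ℝ) : ℂ) * Complex.I) := by
      simp only [dP]; push_cast; ring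
    rwa [h1, norm_mul, Complex.norm_exp_ofReal_mul_I, mul_one]
  have hdQ : ‖dQ‖ ≤ 3 * θ * |σ| := by
    have h1 : dQ = (waveNumber σ ^ 2 - waveNumber 0 ^ 2) * θ * -Complex.I := by
      simp only [dQ]; ring
    rw [h1, norm_mul, norm_mul, norm_neg, Complex.norm_I, mul_one, Complex.norm_real,
      Real.norm_eq_abs, abs_of_nonneg hθ]
    nlinarith
  have h1 : m - transmittedSlope α θ = Complex.exp (scalingAngle α * Complex.I) *
      (Complex.exp (-scalingAngle α * Complex.I) * m - m₀) := by
    rw [hslope, mul_sub, ← mul_assoc, ← Complex.exp_add]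
    simp
  rw [h1, norm_mul, Complex.norm_exp_ofReal_mul_I, one_mul]
  rw [hmv, hm₀] at key
  change _ ≤ 4 / c * weightedMass α u₀ * (‖dP‖ ^ 2 + ‖dQ‖ ^ 2) at key
  have h2 : ‖dP * moment 0 u₀ + dQ * moment α u₀‖ ≤
      (3 * ‖moment 0 u₀‖ + 3 * θ * ‖moment α u₀‖) * |σ| := by
    refine (norm_add_le _ _).trans ?_
    rw [norm_mul, norm_mul]
    have h3 := mul_le_mul_of_nonneg_right hdP (norm_nonneg (moment 0 u₀))
    have h4 := mul_le_mul_of_nonneg_right hdQ (norm_nonneg (moment α u₀))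
    linarith
  have h5 : ‖dP‖ ^ 2 + ‖dQ‖ ^ 2 ≤ (9 + 9 * θ ^ 2) * |σ| := by
    have h6 := pow_le_pow_left₀ (norm_nonneg _) hdP 2
    have h7 := pow_le_pow_left₀ (norm_nonneg _) hdQ 2
    have h8 : |σ| ^ 2 ≤ |σ| := by
      have : |σ| ≤ 1 := by linarith
      nlinarith [abs_nonneg σ]
    have h9 : 0 ≤ 9 + 9 * θ ^ 2 := by positivity
    nlinarith
  have h10 := mul_le_mul_of_nonneg_left h5
    (by positivity : 0 ≤ 4 / c * weightedMass α u₀)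
  have h11 := norm_sub_norm_le (Complex.exp (-scalingAngle α * Complex.I) * m - m₀)
    (dP * moment 0 u₀ + dQ * moment α u₀)
  linarith

end

/-! ### The reflection coefficient for small `θ` -/

section

variable {α : ℝ}

/-- For `θ = 0` the transmitted wave is `exp (-i x)`; on the turned half line it decays. -/
theorem isWeylSol_homogeneous (hα : 0 < α) :
    IsWeylSol (pot α (Complex.exp (-(2 * scalingAngle α) * Complex.I)) 0)
      (fun t => Complex.exp (-Complex.I * Complex.exp (-scalingAngle α * Complex.I) * t))
      (fun t => -Complex.I * Complex.exp (-scalingAngle α * Complex.I) *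
        Complex.exp (-Complex.I * Complex.exp (-scalingAngle α * Complex.I) * t)) := by
  set s := scalingAngle α
  set a : ℂ := -Complex.I * Complex.exp (-s * Complex.I)
  have ha2 : a * a = -Complex.exp (-(2 * s) * Complex.I) := by
    have h2 : Complex.exp (-(2 * s) * Complex.I) =
        Complex.exp (-s * Complex.I) * Complex.exp (-s * Complex.I) := by
      rw [← Complex.exp_add]; congr 1; ring
    rw [h2]
    simp only [a]
    linear_combination Complex.exp (-s * Complex.I) ^ 2 * Complex.I_sq
  have hare : a.re = -Real.sin s := by
    have h1 : Complex.exp (-s * Complex.I) = Real.cos s - Real.sin s * Complex.I := by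
      rw [← Complex.ofReal_neg, Complex.exp_mul_I, ← Complex.ofReal_cos, ← Complex.ofReal_sin,
        Real.cos_neg, Real.sin_neg]
      push_cast; ring
    simp only [a]
    rw [h1, Complex.mul_re]
    simp [-Complex.ofReal_cos, -Complex.ofReal_sin]
  have hexp : ∀ t : ℝ, HasDerivAt (fun t : ℝ => Complex.exp (a * t)) (a * Complex.exp (a * t)) t :=
    fun t => by
      have hid : HasDerivAt (fun t : ℝ => (t : ℂ)) 1 t := Complex.ofRealCLM.hasDerivAt
      exact ((hid.const_mul a).cexp).congr_deriv (by ring)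
  have hdec : ExpDecay fun t : ℝ => Complex.exp (a * t) :=
    ExpDecay.of_le (K := 1) (sin_scalingAngle_pos hα) fun t _ => by
      rw [Complex.norm_exp, one_mul, Complex.re_mul_ofReal, hare]
  refine ⟨⟨hexp, fun t => ((hexp t).const_mul a).congr_deriv ?_⟩, by simp, hdec,
    hdec.const_mul a⟩
  rw [pot, ← mul_assoc, ha2]
  ring

/-- The first variation in `θ` at `θ = 0`, on the turned half line. Turning back removes the angle
from Euler's integral. -/
theorem moment_homogeneous (hα : 0 < α) :
    moment α (fun t => Complex.exp (-Complex.I * Complex.exp (-scalingAngle α * Complex.I) * t)) =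
      Real.Gamma (α + 1) * (1 / (2 * Complex.I)) ^ ((α + 1 : ℝ) : ℂ) *
        Complex.exp ((α + 1) * scalingAngle α * Complex.I) := by
  set s := scalingAngle α
  have hs : 0 < s := scalingAngle_pos hα
  have hs4 : s ≤ Real.pi / 4 := scalingAngle_le hα
  have hpi := Real.pi_pos
  set r : ℂ := 2 * Complex.I * Complex.exp (-s * Complex.I)
  -- both `1 / r` and `1 / (2 i)` have their arguments in `(-π, π]`
  have hr_inv : 1 / r =
      ((1 / 2 : ℝ) : ℂ) * Complex.exp (((s - Real.pi / 2 : ℝ) : ℂ) * Complex.I) := by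
    have h1 : Complex.exp (((s - Real.pi / 2 : ℝ) : ℂ) * Complex.I) =
        Complex.exp (s * Complex.I) * -Complex.I := by
      have : ((s - Real.pi / 2 : ℝ) : ℂ) * Complex.I =
        s * Complex.I + -(Real.pi / 2 * Complex.I) := by push_cast; ring
      rw [this, Complex.exp_add, Complex.exp_neg (Real.pi / 2 * Complex.I),
        Complex.exp_pi_div_two_mul_I, Complex.inv_I]
    have h2 : Complex.exp (-s * Complex.I) = (Complex.exp (s * Complex.I))⁻¹ := by
      rw [neg_mul, Complex.exp_neg]
    have h3 := Complex.exp_ne_zero (s * Complex.I)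
    simp only [r]
    rw [h1, h2]
    field_simp
    push_cast
    linear_combination Complex.I_sq
  have hi_inv : 1 / (2 * Complex.I) =
      ((1 / 2 : ℝ) : ℂ) * Complex.exp (((-(Real.pi / 2) : ℝ) : ℂ) * Complex.I) := by
    have : ((-(Real.pi / 2) : ℝ) : ℂ) * Complex.I = -(Real.pi / 2 * Complex.I) := by
      push_cast; ring
    rw [this, Complex.exp_neg, Complex.exp_pi_div_two_mul_I]
    push_cast
    field_simp
  have hpow : ∀ φ : ℝ, -Real.pi < φ → φ ≤ Real.pi →
      (((1 / 2 : ℝ) : ℂ) * Complex.exp ((φ : ℂ) * Complex.I)) ^ ((α + 1 : ℝ) : ℂ) =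
        Complex.exp ((Real.log (1 / 2) + φ * Complex.I) * ((α + 1 : ℝ) : ℂ)) := by
    intro φ h1 h2
    rw [Complex.cpow_def_of_ne_zero (mul_ne_zero (by norm_num) (Complex.exp_ne_zero _)),
      Complex.log_ofReal_mul (by norm_num) (Complex.exp_ne_zero _),
      Complex.log_exp (by simpa using h1) (by simpa using h2)]
  have hr : 0 < r.re := by
    have h1 : Complex.exp (-s * Complex.I) = Real.cos s - Real.sin s * Complex.I := by
      rw [← Complex.ofReal_neg, Complex.exp_mul_I, ← Complex.ofReal_cos, ← Complex.ofReal_sin,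
        Real.cos_neg, Real.sin_neg]
      push_cast; ring
    have h2 : r.re = 2 * Real.sin s := by
      simp only [r]
      rw [h1, Complex.mul_re]
      simp [-Complex.ofReal_cos, -Complex.ofReal_sin]
    rw [h2]
    have := sin_scalingAngle_pos hα
    positivity
  have hint := integral_rpow_mul_cexp hα hr
  have hm : moment α (fun t => Complex.exp (-Complex.I * Complex.exp (-s * Complex.I) * t)) =
      ∫ t in Ioi (0 : ℝ), ((t ^ α : ℝ) : ℂ) * Complex.exp (-(r * t)) := by
    refine setIntegral_congr_fun measurableSet_Ioi fun t _ => ?_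
    simp only [r]
    rw [← Complex.exp_nat_mul]
    congr 2
    push_cast
    ring
  rw [hm, hint, hr_inv, hi_inv, hpow _ (by linarith) (by linarith),
    hpow _ (by linarith) (by linarith), mul_comm, mul_assoc, ← Complex.exp_add]
  congr 2
  push_cast
  ring

theorem leadingCoefficient_eq :
    leadingCoefficient α = Real.Gamma (α + 1) * (1 / (2 * Complex.I)) ^ ((α + 1 : ℝ) : ℂ) *
      (1 / (2 * Complex.I)) := by
  have h2 : (2 * Complex.I) ≠ 0 := by simp
  have harg : (2 * Complex.I).arg = Real.pi / 2 := by
    have := Complex.arg_real_mul Complex.I (r := 2) two_pos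
    rw [Complex.arg_I] at this
    exact_mod_cast this
  have h3 : ((α + 2 : ℝ) : ℂ) = ((α + 1 : ℝ) : ℂ) + 1 := by push_cast; ring
  rw [leadingCoefficient, h3, Complex.cpow_add _ _ h2, Complex.cpow_one, one_div,
    Complex.inv_cpow _ _ (by rw [harg]; linarith [Real.pi_pos])]
  field_simp

/-- First order expansion of the Weyl coefficient in `θ`. -/
theorem exists_norm_transmittedSlope_sub_le (hα : 0 < α) :
    ∃ K : ℝ, 0 ≤ K ∧ ∀ θ : ℝ, 0 ≤ θ →
      ‖transmittedSlope α θ + Complex.I - 2 * Complex.I * leadingCoefficient α * θ‖ ≤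
        K * θ ^ 2 := by
  have h₀ := isWeylSol_homogeneous hα
  have hmom := moment_homogeneous hα
  set u₀ : ℝ → ℂ :=
    fun t => Complex.exp (-Complex.I * Complex.exp (-scalingAngle α * Complex.I) * t)
  set c := Real.sin (scalingAngle α) / 4
  have hc : 0 < c := by have := sin_scalingAngle_pos hα; positivity
  have hJ : 0 ≤ weightedMass α u₀ :=
    setIntegral_nonneg measurableSet_Ioi fun t _ => by positivity
  refine ⟨4 / c * weightedMass α u₀, by positivity, fun θ hθ => ?_⟩
  obtain ⟨m, ⟨u, v, h, hm⟩, hslope⟩ := exists_transmittedSlope_eq hα hθ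
  have hd := isDissipative_scaledPot (σ := 0) hα hθ ⟨by norm_num, le_rfl⟩
  have key := h₀.norm_weylCoeff_sub_le hα h hd
  rw [hm] at key
  have hP : waveNumber 0 ^ 2 * Complex.exp (-(2 * scalingAngle α) * Complex.I) -
      Complex.exp (-(2 * scalingAngle α) * Complex.I) = 0 := by simp
  have hQ : waveNumber 0 ^ 2 * θ * -Complex.I - 0 = -Complex.I * θ := by simp; ring
  have hnorm : ‖-Complex.I * (θ : ℂ)‖ ^ 2 = θ ^ 2 := by simp
  rw [hP, hQ, hnorm, norm_zero, zero_mul, zero_add, hmom] at key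
  simp only [Complex.ofReal_zero, mul_zero, Complex.exp_zero, mul_one, ne_eq,
    OfNat.ofNat_ne_zero, not_false_eq_true, zero_pow, zero_add] at key
  set E := Complex.exp (scalingAngle α * Complex.I)
  have hE1 : E * Complex.exp (-scalingAngle α * Complex.I) = 1 := by
    rw [← Complex.exp_add]; simp
  have hE2 : E * Complex.exp ((α + 1) * scalingAngle α * Complex.I) = Complex.I := by
    have h1 := exp_mul_scalingAngle hα
    have h2 : E * Complex.exp ((α + 1) * scalingAngle α * Complex.I) *
        Complex.exp (-((α + 2) * scalingAngle α) * Complex.I) = 1 := by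
      have h3 : scalingAngle α * Complex.I + (α + 1) * scalingAngle α * Complex.I +
          -((α + 2) * scalingAngle α) * Complex.I = (0 : ℂ) := by ring
      rw [← Complex.exp_add, ← Complex.exp_add, h3, Complex.exp_zero]
    rw [h1] at h2
    linear_combination Complex.I * h2 +
      E * Complex.exp ((α + 1) * scalingAngle α * Complex.I) * (Complex.I_sq)
  have hEn : ‖E‖ = 1 := Complex.norm_exp_ofReal_mul_I _
  refine le_trans (le_of_eq ?_) key
  have hE : ∀ z : ℂ, ‖z‖ = ‖E * z‖ := fun z => by rw [norm_mul, hEn, one_mul]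
  rw [hE (m - _ - _), hslope, leadingCoefficient_eq]
  congr 1
  have h2i : (2 * Complex.I) * (1 / (2 * Complex.I)) = 1 := mul_one_div_cancel (by simp)
  set G := (Real.Gamma (α + 1) : ℂ) * (1 / (2 * Complex.I)) ^ ((α + 1 : ℝ) : ℂ)
  linear_combination (-G * θ) * h2i - Complex.I * hE1 - Complex.I * θ * G * hE2 -
    θ * G * Complex.I_sq

/-- The quotient of the left-going and the right-going component at `0` of the transmitted
wave. -/
noncomputable def reflectionCoeff (α θ : ℝ) : ℂ :=
  (1 - Complex.I * transmittedSlope α θ) / (1 + Complex.I * transmittedSlope α θ)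

/-- The denominator stays away from `0` for small `θ`, as `transmittedSlope α 0 = -i`. -/
theorem exists_reflectionCoeff_expansion (hα : 0 < α) :
    ∃ K θ₀ : ℝ, 0 ≤ K ∧ 0 < θ₀ ∧ θ₀ ≤ 1 ∧ ∀ θ : ℝ, 0 < θ → θ < θ₀ →
      1 + Complex.I * transmittedSlope α θ ≠ 0 ∧
      ‖reflectionCoeff α θ - leadingCoefficient α * θ‖ ≤ K * θ ^ 2 := by
  obtain ⟨K, hK, hexp⟩ := exists_norm_transmittedSlope_sub_le hα
  set L := 2 * ‖leadingCoefficient α‖ + K with hL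
  have hL0 : 0 ≤ L := by positivity
  refine ⟨K + L ^ 2, 1 / (L + 1), by positivity, by positivity,
    div_le_one_of_le₀ (by linarith) (by positivity), fun θ hθ hθ₀ => ?_⟩
  have h1 := hexp θ hθ.le
  have hθL : θ * (L + 1) < 1 := (lt_div_iff₀ (by positivity)).1 hθ₀
  have hθ1 : θ ≤ 1 := by nlinarith
  set d := transmittedSlope α θ + Complex.I with hd
  have hdn : ‖d‖ ≤ L * θ := by
    have h2 := norm_sub_norm_le d (2 * Complex.I * leadingCoefficient α * θ)
    have h3 : ‖2 * Complex.I * leadingCoefficient α * (θ : ℂ)‖ =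
        2 * ‖leadingCoefficient α‖ * θ := by
      simp [abs_of_pos hθ]
    have h4 : K * θ ^ 2 ≤ K * θ := by nlinarith [mul_nonneg hK hθ.le]
    rw [h3] at h2
    simp only [hL]
    linarith
  have hd1 : ‖d‖ ≤ 1 := by nlinarith
  have hden : 1 + Complex.I * transmittedSlope α θ = 2 + Complex.I * d := by
    rw [hd]; linear_combination -Complex.I_sq
  have hnum : 1 - Complex.I * transmittedSlope α θ = -Complex.I * d := by
    rw [hd]; linear_combination Complex.I_sq
  have hlow : 1 ≤ ‖2 + Complex.I * d‖ := by
    have h5 := norm_sub_norm_le (2 : ℂ) (-(Complex.I * d))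
    rw [sub_neg_eq_add, norm_neg, norm_mul, Complex.norm_I, one_mul] at h5
    have h6 : ‖(2 : ℂ)‖ = 2 := by simp
    linarith
  have hne : 2 + Complex.I * d ≠ 0 := fun h => by
    rw [h, norm_zero] at hlow
    linarith
  refine ⟨by rwa [hden], ?_⟩
  rw [reflectionCoeff, hden, hnum]
  have h7 : -Complex.I * d / (2 + Complex.I * d) - leadingCoefficient α * θ =
      -Complex.I / 2 * (d - 2 * Complex.I * leadingCoefficient α * θ) -
        d ^ 2 / (2 * (2 + Complex.I * d)) := by
    field_simp
    linear_combination (d ^ 2 - leadingCoefficient α * θ * (2 + Complex.I * d) * 2) * Complex.I_sq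
  have h8 : ‖-Complex.I / 2 * (d - 2 * Complex.I * leadingCoefficient α * θ)‖ ≤ K * θ ^ 2 := by
    rw [norm_mul, norm_div, norm_neg, Complex.norm_I]
    simp only [Complex.norm_ofNat]
    linarith [norm_nonneg (d - 2 * Complex.I * leadingCoefficient α * θ)]
  have h9 : ‖d ^ 2 / (2 * (2 + Complex.I * d))‖ ≤ L ^ 2 * θ ^ 2 := by
    rw [norm_div, norm_pow, norm_mul]
    simp only [Complex.norm_ofNat]
    have h10 := pow_le_pow_left₀ (norm_nonneg _) hdn 2
    rw [mul_pow] at h10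
    exact (div_le_self (sq_nonneg _) (by linarith)).trans h10
  rw [h7]
  refine (norm_sub_le _ _).trans ?_
  linarith

end

/-! ### Polarized solutions of the model equation -/

theorem isPolarized_of_family {S : ℝ → (ℝ → ℂ) → Prop} {l : Filter ℝ} {T : Set ℝ}
    {W : ℝ → ℝ → ℂ} (hW : ∀ σ ∈ T, S σ (W σ) ∧ Tendsto (W σ) l (𝓝 0)) (h0 : S 0 (W 0))
    (h1 : W 0 0 = 1) (hlim : TendstoLocallyUniformly W (W 0) (𝓝[T] 0)) :
    IsPolarized S l T (W 0) :=
  ⟨fun h => by simp [h] at h1, h0, W, hW, hlim⟩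

/-- If the decaying solutions of each damped equation are the multiples of one of them, then the
polarized solutions are the multiples of the limit. -/
theorem IsPolarized.eq_mul {S : ℝ → (ℝ → ℂ) → Prop} {l : Filter ℝ} {T : Set ℝ}
    [(𝓝[T] (0 : ℝ)).NeBot] {W : ℝ → ℝ → ℂ} {u : ℝ → ℂ} (hu : IsPolarized S l T u)
    (hlim : TendstoLocallyUniformly W (W 0) (𝓝[T] 0))
    (huniq : ∀ σ ∈ T, ∀ U, S σ U → Tendsto U l (𝓝 0) → ∀ x, U x = U 0 * W σ x) :
    u 0 ≠ 0 ∧ u = fun x => u 0 * W 0 x := by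
  obtain ⟨hne, -, U, hU, hUlim⟩ := hu
  have heq : u = fun x => u 0 * W 0 x := by
    funext x
    have hat : ∀ {F : ℝ → ℝ → ℂ} {f : ℝ → ℂ}, TendstoLocallyUniformly F f (𝓝[T] 0) →
        ∀ y, Tendsto (fun σ => F σ y) (𝓝[T] 0) (𝓝 (f y)) := fun h y =>
      (tendstoLocallyUniformlyOn_univ.2 h).tendsto_at (mem_univ y)
    refine tendsto_nhds_unique (hat hUlim x) (((hat hUlim 0).mul (hat hlim x)).congr' ?_)
    filter_upwards [self_mem_nhdsWithin] with σ hσ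
    exact (huniq σ hσ (U σ) (hU σ hσ).1 (hU σ hσ).2 x).symm
  refine ⟨fun h0 => hne ?_, heq⟩
  rw [heq]
  funext x
  simp [h0]

section

variable {α θ : ℝ}

theorem pot_one_eq (x : ℝ) : pot α 1 θ x = (invSqSpeed α θ x : ℂ) := by
  simp [pot, invSqSpeed]

theorem modelPot_eq (σ x : ℝ) : modelPot α θ σ x = waveNumber σ ^ 2 * pot α 1 θ x := by
  simp only [modelPot, pot]; ring

theorem continuous_modelPot (hα : 0 < α) (σ : ℝ) : Continuous (modelPot α θ σ) :=
  continuous_pot hα _ _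

theorem IsSol.isModelSolution (hα : 0 < α) {σ : ℝ} {u v : ℝ → ℂ}
    (h : IsSol (modelPot α θ σ) u v) : IsModelSolution α θ σ u := by
  have hu : deriv u = v := funext fun x => (h.hu x).deriv
  have hv : deriv v = fun x => -(modelPot α θ σ x * u x) := funext fun x => (h.hv x).deriv
  refine ⟨?_, fun x => ?_⟩
  · rw [← one_add_one_eq_two, contDiff_succ_iff_deriv]
    refine ⟨fun x => (h.hu x).differentiableAt, by simp, ?_⟩
    rw [hu, contDiff_one_iff_deriv]
    refine ⟨fun x => (h.hv x).differentiableAt, ?_⟩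
    rw [hv]
    exact ((continuous_modelPot hα σ).mul h.continuous).neg
  · rw [hu, hv]
    simp only [modelPot_eq, pot_one_eq, waveNumber]
    ring

theorem IsModelSolution.isSol {σ : ℝ} {u : ℝ → ℂ} (h : IsModelSolution α θ σ u) :
    IsSol (modelPot α θ σ) u (deriv u) where
  hu x := (h.1.differentiable (by norm_num) x).hasDerivAt
  hv x := by
    have h1 : Differentiable ℝ (deriv u) := by
      have := h.1
      rw [← one_add_one_eq_two, contDiff_succ_iff_deriv] at this
      exact this.2.2.differentiable (by norm_num)
    refine (h1 x).hasDerivAt.congr_deriv ?_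
    have h2 := h.2 x
    rw [modelPot_eq, pot_one_eq, waveNumber]
    linear_combination h2

theorem tendstoLocallyUniformly_of_isSol (hα : 0 < α) {T : Set ℝ} {W W' : ℝ → ℝ → ℂ}
    (hW : ∀ σ, IsSol (modelPot α θ σ) (W σ) (W' σ)) (h0 : ∀ σ, W σ 0 = 1)
    (hlim : Tendsto (fun σ => W' σ 0) (𝓝[T] 0) (𝓝 (W' 0 0))) :
    TendstoLocallyUniformly W (W 0) (𝓝[T] 0) := by
  rw [Metric.tendstoLocallyUniformly_iff]
  intro ε hε x
  refine ⟨Metric.ball x 1, Metric.ball_mem_nhds x one_pos, ?_⟩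
  set X := |x| + 1
  have hn : Continuous (pot α 1 θ) := continuous_pot hα 1 θ
  obtain ⟨N, hN⟩ := (isCompact_Icc (a := -X) (b := X)).exists_bound_of_continuousOn hn.continuousOn
  obtain ⟨B, hB⟩ := (isCompact_Icc (a := -X) (b := X)).exists_bound_of_continuousOn
    (hn.mul (hW 0).continuous).continuousOn
  have hX : 0 ≤ X := by positivity
  have hN0 : 0 ≤ N := (norm_nonneg _).trans (hN 0 ⟨by linarith, hX⟩)
  have hB0 : 0 ≤ B := (norm_nonneg _).trans (hB 0 ⟨by linarith, hX⟩)
  have hk : Continuous fun σ => waveNumber σ ^ 2 := by unfold waveNumber; fun_prop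
  have hk0 : Tendsto (fun σ => waveNumber σ ^ 2) (𝓝[T] 0) (𝓝 1) := by
    simpa using (hk.tendsto 0).mono_left nhdsWithin_le_nhds
  have hbound : Tendsto (fun σ => (‖W' σ 0 - W' 0 0‖ + ‖waveNumber σ ^ 2 - 1‖ * B) *
      Real.exp ((1 + 2 * N) * X)) (𝓝[T] 0) (𝓝 0) := by
    have h1 := (hlim.sub_const (W' 0 0)).norm
    have h2 := (hk0.sub_const 1).norm
    simpa using (h1.add (h2.mul_const B)).mul_const (Real.exp ((1 + 2 * N) * X))
  filter_upwards [hbound.eventually (gt_mem_nhds hε),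
    hk0.norm.eventually (gt_mem_nhds (by simp : ‖(1 : ℂ)‖ < 2))] with σ h1 h2 y hy
  rw [dist_comm, dist_eq_norm]
  refine lt_of_le_of_lt ?_ h1
  refine (hW σ).norm_sub_le (hW 0) (by positivity) (by positivity) (fun z hz => ?_)
    (fun z hz => ?_) (by simp [h0]) le_rfl ?_
  · rw [modelPot_eq, norm_mul]
    exact mul_le_mul h2.le (hN z (abs_le.1 hz)) (norm_nonneg _) two_pos.le
  · rw [modelPot_eq, modelPot_eq, waveNumber_zero, one_pow, ← sub_mul, mul_assoc, norm_mul]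
    exact mul_le_mul_of_nonneg_left (hB z (abs_le.1 hz)) (norm_nonneg _)
  · have h3 := abs_sub_abs_le_abs_sub y x
    rw [Metric.mem_ball, Real.dist_eq] at hy
    simp only [X]
    linarith

theorem exists_isSol_family (hα : 0 < α) (θ : ℝ) (μ : ℝ → ℂ) :
    ∃ W W' : ℝ → ℝ → ℂ, ∀ σ, IsSol (modelPot α θ σ) (W σ) (W' σ) ∧ W σ 0 = 1 ∧ W' σ 0 = μ σ := by
  choose W W' h using fun σ => exists_isSol (continuous_modelPot (θ := θ) hα σ) 1 (μ σ)
  exact ⟨W, W', h⟩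

theorem IsSol.eq_mul_of_data (hα : 0 < α) {σ : ℝ} {u v w w' : ℝ → ℂ}
    (h : IsSol (modelPot α θ σ) u v) (hw : IsSol (modelPot α θ σ) w w') (hw0 : w 0 = 1)
    (hv : v 0 = w' 0 * u 0) (x : ℝ) : u x = u 0 * w x := by
  have h1 : IsSol (modelPot α θ σ) (fun x => u 0 * w x) (fun x => u 0 * w' x) := by
    simpa using hw.lincomb hw (u 0) 0
  exact congrFun (h.eq_of_data_eq (continuous_modelPot hα σ) h1 (by simp [hw0])
    (by rw [hv, mul_comm])).1 x

/-- The transmitted wave. -/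
theorem exists_isOutgoingPlus (hα : 0 < α) (hθ : 0 ≤ θ) :
    ∃ w w' : ℝ → ℂ, IsSol (modelPot α θ 0) w w' ∧ w 0 = 1 ∧ w' 0 = transmittedSlope α θ ∧
      IsOutgoingPlus (IsModelSolution α θ) w ∧
      ∀ u, IsOutgoingPlus (IsModelSolution α θ) u → u 0 ≠ 0 ∧ u = fun x => u 0 * w x := by
  have hdis := fun (σ : ℝ) (hσ : σ < 0) => isDissipative_modelPot hα hθ hσ
  choose! μ₁ hμ₁ using fun (σ : ℝ) (hσ : σ < 0) => exists_isWeylCoeff hα (hdis σ hσ)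
  set μ : ℝ → ℂ := fun σ => if σ < 0 then μ₁ σ else transmittedSlope α θ
  have hμneg : ∀ σ, σ < 0 → IsWeylCoeff (modelPot α θ σ) (μ σ) := fun σ hσ => by
    simp only [μ, if_pos hσ]; exact hμ₁ σ hσ
  have hμ0 : μ 0 = transmittedSlope α θ := by simp [μ]
  have hμlim : Tendsto μ (𝓝[<] 0) (𝓝 (transmittedSlope α θ)) := by
    obtain ⟨K, hK⟩ := exists_norm_weylCoeff_sub_le hα hθ
    rw [tendsto_iff_norm_sub_tendsto_zero]
    have h0 : Tendsto (fun σ : ℝ => K * |σ|) (𝓝[<] 0) (𝓝 0) := by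
      have : Continuous fun σ : ℝ => K * |σ| := by fun_prop
      simpa using (this.tendsto 0).mono_left nhdsWithin_le_nhds
    refine squeeze_zero' (Eventually.of_forall fun _ => norm_nonneg _) ?_ h0
    filter_upwards [Ico_mem_nhdsLT (show (-1 : ℝ) < 0 by norm_num)] with σ hσ
    exact hK σ hσ.2 hσ.1 _ (hμneg σ hσ.2)
  obtain ⟨W, W', hW⟩ := exists_isSol_family hα θ μ
  have hlim : TendstoLocallyUniformly W (W 0) (𝓝[<] 0) :=
    tendstoLocallyUniformly_of_isSol hα (fun σ => (hW σ).1) (fun σ => (hW σ).2.1)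
      (by simpa only [(hW _).2.2, hμ0] using hμlim)
  refine ⟨W 0, W' 0, (hW 0).1, (hW 0).2.1, (hW 0).2.2.trans hμ0,
    isPolarized_of_family (fun σ hσ => ⟨(hW σ).1.isModelSolution hα, ?_⟩)
      ((hW 0).1.isModelSolution hα) (hW 0).2.1 hlim,
    fun u hu => hu.eq_mul hlim fun σ hσ U hU hUlim x => ?_⟩
  · obtain ⟨u, v, h, hv⟩ := hμneg σ hσ
    have := ((hW σ).1.eq_of_data_eq (continuous_modelPot hα σ) h.sol
      ((hW σ).2.1.trans h.data.symm) ((hW σ).2.2.trans hv.symm)).1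
    rw [this]
    exact h.decay.tendsto
  · obtain ⟨B, hB⟩ := bounded_of_tendsto hU.isSol.continuous hUlim
    refine hU.isSol.eq_mul_of_data hα (hW σ).1 (hW σ).2.1 ?_ x
    rw [(hμneg σ hσ).deriv_eq (hdis σ hσ) hU.isSol hB, (hW σ).2.2]

/-- On the homogeneous half line `x ≤ 0` the equation has exponential solutions. -/
theorem IsSol.eq_exp_of_nonpos (hα : 0 < α) {σ : ℝ} {ζ : ℂ} (hζ : ζ ^ 2 = -waveNumber σ ^ 2)
    {w w' : ℝ → ℂ} (h : IsSol (modelPot α θ σ) w w') (h0 : w 0 = 1) (h1 : w' 0 = ζ) {x : ℝ}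
    (hx : x ≤ 0) : w x = Complex.exp (ζ * x) := by
  have hexp : ∀ t : ℝ, HasDerivAt (fun t : ℝ => Complex.exp (ζ * t)) (ζ * Complex.exp (ζ * t)) t :=
    fun t => by
      have hid : HasDerivAt (fun t : ℝ => (t : ℂ)) 1 t := Complex.ofRealCLM.hasDerivAt
      exact ((hid.const_mul ζ).cexp).congr_deriv (by ring)
  have hsol : IsSol (fun _ => waveNumber σ ^ 2) (fun t : ℝ => Complex.exp (ζ * t))
      (fun t : ℝ => ζ * Complex.exp (ζ * t)) :=
    ⟨hexp, fun t => ((hexp t).const_mul ζ).congr_deriv (by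
      linear_combination Complex.exp (ζ * t) * hζ)⟩
  have hV : ∀ y ∈ Icc 0 (-x), modelPot α θ σ (-y) = waveNumber σ ^ 2 := fun y hy =>
    pot_of_nonpos hα _ _ (by linarith [hy.1])
  have := h.reflect.norm_sub_le_of_nonneg hsol.reflect (δ := 0) (ε := 0)
    (M := ‖waveNumber σ ^ 2‖) le_rfl (norm_nonneg _) (fun y hy => by rw [hV y hy])
    (fun y hy => by rw [hV y hy]; simp) (by simp [h0]) (by simp [h1])
    (show -x ∈ Icc 0 (-x) from ⟨by linarith, le_rfl⟩)
  simpa [sub_eq_zero] using this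

/-- A growing exponent `ζ` singles out the solutions that tend to `0` at `-∞`. -/
theorem isWeylCoeff_reflect (hα : 0 < α) {σ : ℝ} {ζ : ℂ} (hζ : ζ ^ 2 = -waveNumber σ ^ 2)
    (hre : 0 < ζ.re) {w w' : ℝ → ℂ} (h : IsSol (modelPot α θ σ) w w') (h0 : w 0 = 1)
    (h1 : w' 0 = ζ) : IsWeylCoeff (fun x => modelPot α θ σ (-x)) (-ζ) := by
  have hdec : ExpDecay fun x => w (-x) := ExpDecay.of_le (K := 1) hre fun t ht => by
    rw [h.eq_exp_of_nonpos hα hζ h0 h1 (by linarith), Complex.norm_exp, one_mul,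
      Complex.re_mul_ofReal]
    exact le_of_eq (by ring_nf)
  refine ⟨_, _, ⟨h.reflect, by simp [h0], hdec, ?_⟩, by simp [h1]⟩
  refine (hdec.const_mul (-ζ)).mono (EventuallyEq.isBigO ?_)
  filter_upwards [eventually_gt_atTop 0] with t ht
  have hd : HasDerivAt (fun t : ℝ => Complex.exp (ζ * t)) (ζ * Complex.exp (ζ * (-t : ℝ))) (-t) := by
    have hid : HasDerivAt (fun t : ℝ => (t : ℂ)) 1 (-t) := Complex.ofRealCLM.hasDerivAt
    exact ((hid.const_mul ζ).cexp).congr_deriv (by ring)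
  have heq : w =ᶠ[𝓝 (-t)] fun t : ℝ => Complex.exp (ζ * t) := by
    filter_upwards [Iio_mem_nhds (show -t < 0 by linarith)] with y hy
    exact h.eq_exp_of_nonpos hα hζ h0 h1 (le_of_lt hy)
  rw [(h.hu (-t)).unique (hd.congr_of_eventuallyEq heq), heq.eq_of_nhds]
  ring

/-- If `ζ` has positive real part, then `x ↦ -x` turns the equation into a dissipative one in the
direction `ω = i / ζ`, for which `ω V = -i ζ` on the homogeneous half line. -/
theorem isDissipative_reflect (hα : 0 < α) {σ : ℝ} {ζ : ℂ} (hζ : ζ ^ 2 = -waveNumber σ ^ 2)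
    (hre : 0 < ζ.re) : IsDissipative (ζ.re / Complex.normSq ζ) (Complex.I / ζ)
      (fun x => modelPot α θ σ (-x)) := by
  have hζ0 : ζ ≠ 0 := fun h => by simp [h] at hre
  have hnorm : 1 ≤ ‖ζ‖ := by
    have h1 : ‖ζ‖ ^ 2 = ‖waveNumber σ‖ ^ 2 := by rw [← norm_pow, hζ, norm_neg, norm_pow]
    rw [(sq_eq_sq₀ (norm_nonneg _) (norm_nonneg _)).1 h1]
    exact one_le_norm_waveNumber σ
  have hsq : 1 ≤ Complex.normSq ζ := by
    rw [Complex.normSq_eq_norm_sq]; exact one_le_pow₀ hnorm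
  refine ⟨div_pos hre (by linarith), ?_, ?_, fun x hx => ?_⟩
  · rw [norm_div, Complex.norm_I]
    exact (div_le_one_of_le₀ hnorm (norm_nonneg _)).trans one_le_two
  · simp [Complex.div_im]
  · have h1 : Complex.I / ζ * modelPot α θ σ (-x) = -(Complex.I * ζ) := by
      rw [modelPot, pot_of_nonpos hα _ _ (by linarith)]
      field_simp
      linear_combination hζ
    rw [h1, Complex.neg_im, Complex.I_mul_im, neg_le_neg_iff]
    exact div_le_self hre.le hsq

/-- The waves polarized at `-∞`: the reflected one for `ε = 1` and the incident one for
`ε = -1`. -/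
theorem exists_isPolarized_atBot (hα : 0 < α) (θ : ℝ) {T : Set ℝ} [(𝓝[T] (0 : ℝ)).NeBot] {ε : ℝ}
    (hε : ε ^ 2 = 1) (hT : ∀ σ ∈ T, ε * σ < 0) :
    ∃ w w' : ℝ → ℂ, IsSol (modelPot α θ 0) w w' ∧ w 0 = 1 ∧ w' 0 = ε * Complex.I ∧
      IsPolarized (IsModelSolution α θ) atBot T w ∧
      (∀ u, IsPolarized (IsModelSolution α θ) atBot T u → u = fun x => u 0 * w x) ∧
      ∀ x ≤ 0, w x = Complex.exp (ε * Complex.I * x) := by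
  have hε' : (ε : ℂ) ^ 2 = 1 := by exact_mod_cast hε
  have hζ : ∀ σ : ℝ, (ε * Complex.I * waveNumber σ) ^ 2 = -waveNumber σ ^ 2 := fun σ => by
    rw [mul_pow, mul_pow, hε', Complex.I_sq]; ring
  have hre : ∀ σ ∈ T, 0 < (ε * Complex.I * waveNumber σ).re := fun σ hσ => by
    have h1 := hT σ hσ
    have h2 : (ε * Complex.I * waveNumber σ).re = -(ε * σ) := by
      rw [mul_assoc, Complex.re_ofReal_mul, Complex.I_mul_re, waveNumber_im]; ring
    rw [h2]
    linarith
  obtain ⟨W, W', hW⟩ := exists_isSol_family hα θ fun σ => ε * Complex.I * waveNumber σ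
  have hlim : TendstoLocallyUniformly W (W 0) (𝓝[T] 0) := by
    refine tendstoLocallyUniformly_of_isSol hα (fun σ => (hW σ).1) (fun σ => (hW σ).2.1) ?_
    simp only [(hW _).2.2]
    have : Continuous fun σ => ε * Complex.I * waveNumber σ := by unfold waveNumber; fun_prop
    exact (this.tendsto 0).mono_left nhdsWithin_le_nhds
  refine ⟨W 0, W' 0, (hW 0).1, (hW 0).2.1, by simp [(hW 0).2.2],
    isPolarized_of_family (fun σ hσ => ⟨(hW σ).1.isModelSolution hα, ?_⟩)
      ((hW 0).1.isModelSolution hα) (hW 0).2.1 hlim,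
    fun u hu => (hu.eq_mul hlim fun σ hσ U hU hUlim x => ?_).2,
    fun x hx => ?_⟩
  · obtain ⟨u, v, h, -⟩ := isWeylCoeff_reflect hα (hζ σ) (hre σ hσ) (hW σ).1 (hW σ).2.1
      (hW σ).2.2
    have hdec : Tendsto (fun x => W σ (-x)) atTop (𝓝 0) := by
      refine (ExpDecay.of_le (K := 1) (hre σ hσ) fun t ht => ?_).tendsto
      rw [(hW σ).1.eq_exp_of_nonpos hα (hζ σ) (hW σ).2.1 (hW σ).2.2 (by linarith),
        Complex.norm_exp, one_mul, Complex.re_mul_ofReal]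
      exact le_of_eq (by ring_nf)
    simpa [Function.comp_def] using hdec.comp tendsto_neg_atBot_atTop
  · have hUr := hU.isSol.reflect
    obtain ⟨B, hB⟩ := bounded_of_tendsto hUr.continuous (hUlim.comp tendsto_neg_atTop_atBot)
    have h1 := (isWeylCoeff_reflect hα (hζ σ) (hre σ hσ) (hW σ).1 (hW σ).2.1
      (hW σ).2.2).deriv_eq (isDissipative_reflect hα (hζ σ) (hre σ hσ)) hUr hB
    simp only [neg_zero] at h1
    refine hU.isSol.eq_mul_of_data hα (hW σ).1 (hW σ).2.1 ?_ x
    rw [(hW σ).2.2]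
    linear_combination -h1
  · have := (hW 0).1.eq_exp_of_nonpos hα (hζ 0) (hW 0).2.1 (hW 0).2.2 hx
    simpa using this

/-! ### The reflection coefficient of the model equation -/

theorem invSqSpeed_of_nonpos (hα : 0 < α) {x : ℝ} (hx : x ≤ 0) : invSqSpeed α θ x = 1 := by
  simp [invSqSpeed, max_eq_right hx, Real.zero_rpow hα.ne']

theorem phase_of_nonpos (hα : 0 < α) {x : ℝ} (hx : x ≤ 0) : phase α θ x = x := by
  have : ∫ y in (0 : ℝ)..x, Real.sqrt (invSqSpeed α θ y) = ∫ _ in (0 : ℝ)..x, (1 : ℝ) := by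
    refine intervalIntegral.integral_congr fun y hy => ?_
    rw [uIcc_of_ge hx] at hy
    simp [invSqSpeed_of_nonpos hα hy.2]
  rw [phase, this]
  simp

theorem wkbLeft_of_nonpos (hα : 0 < α) {x : ℝ} (hx : x ≤ 0) :
    wkbLeft α θ x = Complex.exp (Complex.I * x) := by
  simp [wkbLeft, amplitude, invSqSpeed_of_nonpos hα hx, phase_of_nonpos hα hx]

theorem wkbRight_of_nonpos (hα : 0 < α) {x : ℝ} (hx : x ≤ 0) :
    wkbRight α θ x = Complex.exp (-Complex.I * x) := by
  simp [wkbRight, amplitude, invSqSpeed_of_nonpos hα hx, phase_of_nonpos hα hx]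

/-- The reflection coefficient is `reflectionCoeff α θ`: match `u` and `u'` at `0` with the
exponentials in `x ≤ 0`. -/
theorem isModelReflectionCoefficient (hα : 0 < α) (hθ : 0 ≤ θ)
    (hne : 1 + Complex.I * transmittedSlope α θ ≠ 0) :
    IsModelReflectionCoefficient α θ (reflectionCoeff α θ) := by
  obtain ⟨w, w', hw, hw0, hw1, hwpol, hwuniq⟩ := exists_isOutgoingPlus hα hθ
  obtain ⟨p, p', hp, hp0, hp1, hppol, hpuniq, hpexp⟩ := exists_isPolarized_atBot (T := Iio 0) hα θ
    (ε := 1) (by norm_num) (fun σ hσ => by simpa using hσ)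
  obtain ⟨q, q', hq, hq0, hq1, hqpol, hquniq, hqexp⟩ := exists_isPolarized_atBot (T := Ioi 0) hα θ
    (ε := -1) (by norm_num) (fun σ hσ => by simpa using hσ)
  set m := transmittedSlope α θ
  have hratio_p : ∀ (a : ℂ) (x : ℝ), x ≤ 0 → a * p x / wkbLeft α θ x = a := fun a x hx => by
    rw [hpexp x hx, wkbLeft_of_nonpos hα hx]
    simp
  have hratio_q : ∀ (a : ℂ) (x : ℝ), x ≤ 0 → a * q x / wkbRight α θ x = a := fun a x hx => by
    rw [hqexp x hx, wkbRight_of_nonpos hα hx]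
    simp
  have hlim_p : ∀ a : ℂ, Tendsto (fun x => a * p x / wkbLeft α θ x) atBot (𝓝 a) := fun a =>
    tendsto_const_nhds.congr' ((eventually_le_atBot 0).mono fun x hx => (hratio_p a x hx).symm)
  have hlim_q : ∀ a : ℂ, Tendsto (fun x => a * q x / wkbRight α θ x) atBot (𝓝 a) := fun a =>
    tendsto_const_nhds.congr' ((eventually_le_atBot 0).mono fun x hx => (hratio_q a x hx).symm)
  refine ⟨⟨w, hwpol⟩, ⟨p, hppol, by simpa using hlim_p 1⟩, ⟨q, hqpol, by simpa using hlim_q 1⟩, ?_⟩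
  intro uT uR uI hT hR hI
  obtain ⟨hT0, hTw⟩ := hwuniq uT hT
  have hRp : uR = p := by
    have h1 := hpuniq uR hR.1
    have h2 := hR.2
    rw [h1] at h2
    rw [h1, tendsto_nhds_unique (hlim_p (uR 0)) h2]
    simp
  have hIq : uI = q := by
    have h1 := hquniq uI hI.1
    have h2 := hI.2
    rw [h1] at h2
    rw [h1, tendsto_nhds_unique (hlim_q (uI 0)) h2]
    simp
  subst hRp hIq
  -- components of the solution with data `(1, m)`
  have hwpq : w = fun x => (1 - Complex.I * m) / 2 * uR x + (1 + Complex.I * m) / 2 * uI x := by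
    refine (hw.eq_of_data_eq (continuous_modelPot hα 0)
      (hp.lincomb hq ((1 - Complex.I * m) / 2) ((1 + Complex.I * m) / 2)) ?_ ?_).1
    · rw [hw0, hp0, hq0]; ring
    · rw [hw1, hp1, hq1]
      push_cast
      linear_combination m * Complex.I_sq
  refine ⟨⟨uT 0 * ((1 - Complex.I * m) / 2), uT 0 * ((1 + Complex.I * m) / 2), ?_⟩, ?_⟩
  · rw [hTw]
    funext x
    simp only [Pi.add_apply, Pi.smul_apply, smul_eq_mul, hwpq, hp0, hq0]
    ring
  · intro A B hAB
    have h0 : uT 0 = A + B := by simp [hAB, hp0, hq0]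
    have hd1 : HasDerivAt uT (uT 0 * m) 0 := by
      have := (hw.hu 0).const_mul (uT 0)
      rw [hw1] at this
      rwa [← hTw] at this
    have hd2 : HasDerivAt uT (A * Complex.I - B * Complex.I) 0 := by
      have := ((hp.hu 0).const_mul A).add ((hq.hu 0).const_mul B)
      rw [hp1, hq1] at this
      rw [hAB]
      refine HasDerivAt.congr_deriv (f := A • uR + B • uI) this ?_
      push_cast; ring
    have hd := hd1.unique hd2
    have hB : 2 * B = uT 0 * (1 + Complex.I * m) := by
      linear_combination (-1) * h0 - Complex.I * hd - (A - B) * Complex.I_sq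
    have hA : 2 * A = uT 0 * (1 - Complex.I * m) := by
      linear_combination (-1) * h0 + Complex.I * hd + (A - B) * Complex.I_sq
    have hB0 : B ≠ 0 := fun h => by
      rw [h, mul_zero] at hB
      exact mul_ne_zero hT0 hne hB.symm
    refine ⟨hB0, ?_⟩
    rw [reflectionCoeff, div_eq_div_iff hne hB0]
    refine mul_left_cancel₀ (mul_ne_zero two_ne_zero hT0) ?_
    linear_combination uT 0 * (1 - Complex.I * m) * hB - uT 0 * (1 + Complex.I * m) * hA

end

/-! ### Change of units -/

section

variable {S S' : ℝ → (ℝ → ℂ) → Prop} {k : ℝ}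

theorem IsPolarized.comp_mul (hk : 0 < k) (hS : ∀ σ U, S σ U → S' σ fun x => U (k * x))
    {l : Filter ℝ} (hl : Tendsto (fun x => k * x) l l) {T : Set ℝ} {u : ℝ → ℂ}
    (h : IsPolarized S l T u) : IsPolarized S' l T fun x => u (k * x) := by
  obtain ⟨hne, h0, U, hU, hlim⟩ := h
  refine ⟨fun hz => hne ?_, hS 0 u h0, fun σ x => U σ (k * x),
    fun σ hσ => ⟨hS σ _ (hU σ hσ).1, (hU σ hσ).2.comp hl⟩,
    hlim.comp (fun x => k * x) (continuous_const_mul k)⟩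
  funext x
  simpa [mul_inv_cancel_left₀ hk.ne'] using congrFun hz (k⁻¹ * x)

theorem tendsto_div_comp_mul (hk : 0 < k) {u v v' : ℝ → ℂ}
    (hv : ∀ᶠ x in atBot, v' x = v (k * x)) (h : Tendsto (fun x => u x / v x) atBot (𝓝 1)) :
    Tendsto (fun x => u (k * x) / v' x) atBot (𝓝 1) :=
  (h.comp (tendsto_id.const_mul_atBot hk)).congr' (hv.mono fun x hx => by simp [hx])

/-- The reflection coefficient does not depend on the unit of length. -/
theorem IsReflectionCoefficient.comp_mul (hk : 0 < k)
    (hS : ∀ σ U, S σ U → S' σ fun x => U (k * x))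
    (hS' : ∀ σ U, S' σ U → S σ fun x => U (k⁻¹ * x)) {vInc vRef vInc' vRef' : ℝ → ℂ}
    (hInc : ∀ᶠ x in atBot, vInc' x = vInc (k * x)) (hRef : ∀ᶠ x in atBot, vRef' x = vRef (k * x))
    {r : ℂ} (h : IsReflectionCoefficient S vInc vRef r) :
    IsReflectionCoefficient S' vInc' vRef' r := by
  obtain ⟨⟨uT, hT⟩, ⟨uR, hR⟩, ⟨uI, hI⟩, hall⟩ := h
  have hk' : 0 < k⁻¹ := inv_pos.2 hk
  have htop : ∀ {a : ℝ}, 0 < a → Tendsto (fun x => a * x) atTop atTop :=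
    fun ha => tendsto_id.const_mul_atTop ha
  have hbot : ∀ {a : ℝ}, 0 < a → Tendsto (fun x => a * x) atBot atBot :=
    fun ha => tendsto_id.const_mul_atBot ha
  have hInc' : ∀ᶠ x in atBot, vInc x = vInc' (k⁻¹ * x) :=
    ((hbot hk').eventually hInc).mono fun x hx => by rw [hx, mul_inv_cancel_left₀ hk.ne']
  have hRef' : ∀ᶠ x in atBot, vRef x = vRef' (k⁻¹ * x) :=
    ((hbot hk').eventually hRef).mono fun x hx => by rw [hx, mul_inv_cancel_left₀ hk.ne']
  refine ⟨⟨_, IsPolarized.comp_mul hk hS (htop hk) hT⟩,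
    ⟨_, IsPolarized.comp_mul hk hS (hbot hk) hR.1, tendsto_div_comp_mul hk hRef hR.2⟩,
    ⟨_, IsPolarized.comp_mul hk hS (hbot hk) hI.1, tendsto_div_comp_mul hk hInc hI.2⟩, ?_⟩
  intro uT uR uI hT hR hI
  obtain ⟨⟨A, B, hAB⟩, huniq⟩ := hall _ _ _ (IsPolarized.comp_mul hk' hS' (htop hk') hT)
    ⟨IsPolarized.comp_mul hk' hS' (hbot hk') hR.1, tendsto_div_comp_mul hk' hRef' hR.2⟩
    ⟨IsPolarized.comp_mul hk' hS' (hbot hk') hI.1, tendsto_div_comp_mul hk' hInc' hI.2⟩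
  refine ⟨⟨A, B, ?_⟩, fun A B hAB => huniq A B ?_⟩
  · funext x
    simpa [inv_mul_cancel_left₀ hk.ne'] using congrFun hAB (k * x)
  · rw [hAB]
    rfl

end

/-! ### The layered medium -/

theorem deriv_deriv_cexp_mul {f : ℝ → ℝ} {b : ℝ} (hf : ∀ s, HasDerivAt f b s) (a z : ℂ) (t : ℝ) :
    deriv (deriv fun s => Complex.exp (a * (f s : ℂ)) * z) t =
      (a * b) ^ 2 * (Complex.exp (a * (f t : ℂ)) * z) := by
  have h : ∀ (z : ℂ) (s : ℝ), HasDerivAt (fun s => Complex.exp (a * (f s : ℂ)) * z)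
      (Complex.exp (a * (f s : ℂ)) * (a * b * z)) s := fun z s =>
    (((((hf s).ofReal_comp).const_mul a).cexp).mul_const z).congr_deriv (by ring)
  have h1 : deriv (fun s => Complex.exp (a * (f s : ℂ)) * z) =
      fun s => Complex.exp (a * (f s : ℂ)) * (a * b * z) := funext fun s => (h z s).deriv
  rw [h1, (h _ t).deriv]
  ring

variable {c₀ ℓ α ω k₂ k₃ : ℝ}

/-- Separation of variables. -/
theorem isLayeredMode_iff {σ : ℝ} {U : ℝ → ℂ} :
    IsLayeredMode c₀ ℓ α ω k₂ k₃ σ U ↔ ContDiff ℝ 2 U ∧ ∀ x : ℝ,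
      deriv (deriv U) x + (1 + Complex.I * (σ : ℂ)) ^ 2 *
        ((ω ^ 2 * layeredInvSqSpeed c₀ ℓ α x - k₂ ^ 2 - k₃ ^ 2 : ℝ) : ℂ) * U x = 0 := by
  refine and_congr_right fun _ => ?_
  -- the second derivatives in `t`, `x₂`, `x₃` multiply by constants; evaluating at `t = x₂ = x₃ = 0`
  -- gives back the equation for `U`
  set a : ℂ := Complex.I * (1 + Complex.I * (σ : ℂ)) with ha
  have ht : ∀ x₁ x₂ x₃ t : ℝ, deriv (deriv fun s : ℝ =>
      Complex.exp (a * ((ω * s - k₂ * x₂ - k₃ * x₃ : ℝ) : ℂ)) * U x₁) t = (a * ω) ^ 2 *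
        (Complex.exp (a * ((ω * t - k₂ * x₂ - k₃ * x₃ : ℝ) : ℂ)) * U x₁) := fun x₁ x₂ x₃ t =>
    deriv_deriv_cexp_mul (fun s => by
      simpa using (((hasDerivAt_id s).const_mul ω).sub_const (k₂ * x₂)).sub_const (k₃ * x₃)) _ _ _
  have h2 : ∀ t x₁ x₃ x₂ : ℝ, deriv (deriv fun y : ℝ =>
      Complex.exp (a * ((ω * t - k₂ * y - k₃ * x₃ : ℝ) : ℂ)) * U x₁) x₂ =
        (a * ((-k₂ : ℝ) : ℂ)) ^ 2 *
        (Complex.exp (a * ((ω * t - k₂ * x₂ - k₃ * x₃ : ℝ) : ℂ)) * U x₁) := fun t x₁ x₃ x₂ =>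
    deriv_deriv_cexp_mul (fun s => by
      simpa using (((hasDerivAt_id s).const_mul k₂).const_sub (ω * t)).sub_const (k₃ * x₃)) _ _ _
  have h3 : ∀ t x₁ x₂ x₃ : ℝ, deriv (deriv fun y : ℝ =>
      Complex.exp (a * ((ω * t - k₂ * x₂ - k₃ * y : ℝ) : ℂ)) * U x₁) x₃ =
        (a * ((-k₃ : ℝ) : ℂ)) ^ 2 *
        (Complex.exp (a * ((ω * t - k₂ * x₂ - k₃ * x₃ : ℝ) : ℂ)) * U x₁) := fun t x₁ x₂ x₃ =>
    deriv_deriv_cexp_mul (fun s => by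
      simpa using ((hasDerivAt_id s).const_mul k₃).const_sub (ω * t - k₂ * x₂)) _ _ _
  have h1 : ∀ (z : ℂ) (x : ℝ), deriv (deriv fun y => z * U y) x = z * deriv (deriv U) x :=
    fun z x => by
      rw [show (deriv fun y => z * U y) = fun y => z * deriv U y from
        funext fun y => deriv_const_mul_field z, deriv_const_mul_field]
  have ha2 : a ^ 2 = -(1 + Complex.I * (σ : ℂ)) ^ 2 := by
    rw [ha, mul_pow, Complex.I_sq]; ring
  simp only [SolvesWaveEquation, ht, h1, h2, h3]
  constructor
  · intro h x
    have h0 := h 0 x 0 0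
    simp only [mul_zero, sub_zero, Complex.ofReal_zero, Complex.exp_zero, one_mul] at h0
    push_cast at h0 ⊢
    linear_combination -h0 + (layeredInvSqSpeed c₀ ℓ α x * ω ^ 2 * U x - k₂ ^ 2 * U x -
      k₃ ^ 2 * U x) * ha2
  · intro h t x₁ x₂ x₃
    have h0 := h x₁
    set e := Complex.exp (a * ((ω * t - k₂ * x₂ - k₃ * x₃ : ℝ) : ℂ))
    push_cast at h0 ⊢
    linear_combination -e * h0 + e * (layeredInvSqSpeed c₀ ℓ α x₁ * ω ^ 2 * U x₁ -
      k₂ ^ 2 * U x₁ - k₃ ^ 2 * U x₁) * ha2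

section NonGlancing

variable (hc₀ : 0 < c₀) (hℓ : 0 < ℓ) (hω : 0 < ω) (hk : c₀ ^ 2 * (k₂ ^ 2 + k₃ ^ 2) < ω ^ 2)

include hω hk in
theorem one_sub_pos : 0 < 1 - c₀ ^ 2 * (k₂ ^ 2 + k₃ ^ 2) / ω ^ 2 := by
  have h1 : c₀ ^ 2 * (k₂ ^ 2 + k₃ ^ 2) / ω ^ 2 < 1 := (div_lt_one (by positivity)).2 hk
  linarith

include hc₀ hℓ hω hk in
theorem layeredTheta_pos : 0 < layeredTheta c₀ ℓ α ω k₂ k₃ :=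
  mul_pos (Real.rpow_pos_of_pos (by positivity) _)
    (Real.rpow_pos_of_pos (one_sub_pos hω hk) _)

include hc₀ hω in
theorem normalWaveNumber_eq : normalWaveNumber c₀ ω k₂ k₃ =
    ω / c₀ * Real.sqrt (1 - c₀ ^ 2 * (k₂ ^ 2 + k₃ ^ 2) / ω ^ 2) := by
  have h1 : ω ^ 2 / c₀ ^ 2 - k₂ ^ 2 - k₃ ^ 2 =
      (ω / c₀) ^ 2 * (1 - c₀ ^ 2 * (k₂ ^ 2 + k₃ ^ 2) / ω ^ 2) := by
    field_simp; ring
  rw [normalWaveNumber, h1, Real.sqrt_mul (sq_nonneg _), Real.sqrt_sq (by positivity)]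

include hc₀ hω hk in
theorem normalWaveNumber_pos : 0 < normalWaveNumber c₀ ω k₂ k₃ := by
  rw [normalWaveNumber_eq hc₀ hω]
  exact mul_pos (by positivity) (Real.sqrt_pos.2 (one_sub_pos hω hk))

include hc₀ hℓ hω hk in
/-- In the unit of length `1 / k₁` the layered medium is the model medium with parameter
`layeredTheta`. -/
theorem sq_mul_layeredInvSqSpeed_sub (x : ℝ) :
    ω ^ 2 * layeredInvSqSpeed c₀ ℓ α x - k₂ ^ 2 - k₃ ^ 2 =
      normalWaveNumber c₀ ω k₂ k₃ ^ 2 *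
        invSqSpeed α (layeredTheta c₀ ℓ α ω k₂ k₃) (normalWaveNumber c₀ ω k₂ k₃ * x) := by
  have hk₁ := normalWaveNumber_pos hc₀ hω hk
  have hpos := one_sub_pos hω hk
  set k₁ := normalWaveNumber c₀ ω k₂ k₃ with hk₁def
  set D := 1 - c₀ ^ 2 * (k₂ ^ 2 + k₃ ^ 2) / ω ^ 2 with hD
  have hg : 0 < Real.sqrt D := Real.sqrt_pos.2 hpos
  have hk₁eq : k₁ = ω / c₀ * Real.sqrt D := normalWaveNumber_eq hc₀ hω
  have hsq : k₁ ^ 2 = ω ^ 2 / c₀ ^ 2 - k₂ ^ 2 - k₃ ^ 2 := by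
    rw [hk₁eq, mul_pow, Real.sq_sqrt hpos.le, hD]; field_simp; ring
  have hmax : max (k₁ * x) 0 = (k₁ * ℓ) * max (x / ℓ) 0 := by
    rw [mul_max_of_nonneg _ _ (by positivity : 0 ≤ k₁ * ℓ), mul_zero]
    congr 1; field_simp
  have hpow : D ^ (-(α + 2) / 2) = (Real.sqrt D ^ α * Real.sqrt D ^ 2)⁻¹ := by
    rw [← Real.rpow_natCast (Real.sqrt D) 2, ← Real.rpow_add hg, ← Real.rpow_neg hg.le,
      Real.sqrt_eq_rpow, ← Real.rpow_mul hpos.le]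
    congr 1
    push_cast; ring
  have hθ : k₁ ^ 2 * layeredTheta c₀ ℓ α ω k₂ k₃ * (k₁ * ℓ) ^ α = ω ^ 2 / c₀ ^ 2 := by
    have h1 : k₁ * ℓ = (c₀ / (ℓ * ω))⁻¹ * Real.sqrt D := by rw [hk₁eq]; field_simp
    have h2 : (c₀ / (ℓ * ω)) ^ α ≠ 0 := (Real.rpow_pos_of_pos (by positivity) _).ne'
    have h3 : Real.sqrt D ^ α ≠ 0 := (Real.rpow_pos_of_pos hg _).ne'
    rw [layeredTheta, ← hD, hpow, h1, Real.mul_rpow (by positivity) hg.le,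
      Real.inv_rpow (by positivity), hk₁eq]
    field_simp
  rw [layeredInvSqSpeed, invSqSpeed, hmax,
    Real.mul_rpow (by positivity) (le_max_right _ _)]
  have h4 : k₁ ^ 2 * (1 + layeredTheta c₀ ℓ α ω k₂ k₃ * ((k₁ * ℓ) ^ α * max (x / ℓ) 0 ^ α)) =
      k₁ ^ 2 + (k₁ ^ 2 * layeredTheta c₀ ℓ α ω k₂ k₃ * (k₁ * ℓ) ^ α) * max (x / ℓ) 0 ^ α := by
    ring
  rw [h4, hθ, hsq]
  field_simp
  ring

include hc₀ hℓ hω hk in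
/-- Layered modes are rescaled solutions of the model equation. -/
theorem isLayeredMode_comp_mul_iff {σ : ℝ} {u : ℝ → ℂ} :
    IsLayeredMode c₀ ℓ α ω k₂ k₃ σ (fun x => u (normalWaveNumber c₀ ω k₂ k₃ * x)) ↔
      IsModelSolution α (layeredTheta c₀ ℓ α ω k₂ k₃) σ u := by
  have hk₁ := normalWaveNumber_pos hc₀ hω hk
  have hspeed := sq_mul_layeredInvSqSpeed_sub (α := α) hc₀ hℓ hω hk
  rw [isLayeredMode_iff, IsModelSolution]
  set k₁ := normalWaveNumber c₀ ω k₂ k₃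
  have hinv : ∀ x, k₁ * (k₁⁻¹ * x) = x := fun x => mul_inv_cancel_left₀ hk₁.ne' x
  refine and_congr ⟨fun h => ?_, fun h => h.comp (contDiff_const.mul contDiff_id)⟩ ?_
  · have := h.comp (contDiff_const (c := k₁⁻¹).mul contDiff_id)
    simpa [Function.comp_def, hinv] using this
  · have hd : ∀ x, deriv (deriv fun x => u (k₁ * x)) x = (k₁ : ℂ) ^ 2 * deriv (deriv u) (k₁ * x) := by
      intro x
      have h1 : deriv (fun x => u (k₁ * x)) = fun x => (k₁ : ℂ) * deriv u (k₁ * x) := by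
        funext y
        rw [deriv_comp_mul_left, Complex.real_smul]
      rw [h1, deriv_const_mul_field, deriv_comp_mul_left, Complex.real_smul]
      ring
    have hk0 : (k₁ : ℂ) ^ 2 ≠ 0 := pow_ne_zero 2 (Complex.ofReal_ne_zero.2 hk₁.ne')
    have hfac : ∀ x, deriv (deriv fun x => u (k₁ * x)) x + (1 + Complex.I * (σ : ℂ)) ^ 2 *
        ((ω ^ 2 * layeredInvSqSpeed c₀ ℓ α x - k₂ ^ 2 - k₃ ^ 2 : ℝ) : ℂ) * u (k₁ * x) =
        (k₁ : ℂ) ^ 2 * (deriv (deriv u) (k₁ * x) + (1 + Complex.I * (σ : ℂ)) ^ 2 *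
          (invSqSpeed α (layeredTheta c₀ ℓ α ω k₂ k₃) (k₁ * x) : ℂ) * u (k₁ * x)) := fun x => by
      rw [hd, hspeed]
      push_cast
      ring
    simp only [hfac, mul_eq_zero, hk0, false_or]
    exact ⟨fun h x => by simpa only [hinv] using h (k₁⁻¹ * x), fun h x => h (k₁ * x)⟩

include hc₀ hℓ hω hk in
/-- The reference waves agree as well, since the model WKB waves are pure exponentials in `x ≤ 0`. -/
theorem IsModelReflectionCoefficient.layered (hα : 0 < α) {r : ℂ}
    (h : IsModelReflectionCoefficient α (layeredTheta c₀ ℓ α ω k₂ k₃) r) :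
    IsLayeredReflectionCoefficient c₀ ℓ α ω k₂ k₃ r := by
  have hk₁ := normalWaveNumber_pos hc₀ hω hk
  have hiff := fun (σ : ℝ) (u : ℝ → ℂ) =>
    isLayeredMode_comp_mul_iff (α := α) (σ := σ) (u := u) hc₀ hℓ hω hk
  set k₁ := normalWaveNumber c₀ ω k₂ k₃
  refine IsReflectionCoefficient.comp_mul hk₁ (fun σ U hU => (hiff σ U).2 hU)
    (fun σ U hU => (hiff σ _).1 (by simpa [inv_mul_cancel_left₀ hk₁.ne'] using hU)) ?_ ?_ h
  · filter_upwards [eventually_le_atBot 0] with x hx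
    rw [wkbRight_of_nonpos hα (mul_nonpos_of_nonneg_of_nonpos hk₁.le hx)]
  · filter_upwards [eventually_le_atBot 0] with x hx
    rw [wkbLeft_of_nonpos hα (mul_nonpos_of_nonneg_of_nonpos hk₁.le hx)]

end NonGlancing

/-! ### High frequencies -/

theorem freqNorm_pos {δ : ℝ} {ξ : ℝ × ℝ × ℝ} (hξ : ξ ∈ nonGlancing c₀ δ) : 0 < freqNorm ξ := by
  have := hξ.1
  exact Real.sqrt_pos.2 (by positivity)

/-- Away from glancing incidence `θ` is of order `-α`. -/
theorem exists_layeredTheta_le (hα : 0 < α) (hc₀ : 0 < c₀) (hℓ : 0 < ℓ) {δ : ℝ} (hδ : 0 < δ) :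
    ∃ K : ℝ, 0 ≤ K ∧ ∀ ξ ∈ nonGlancing c₀ δ,
      0 < layeredTheta c₀ ℓ α ξ.1 ξ.2.1 ξ.2.2 ∧
      layeredTheta c₀ ℓ α ξ.1 ξ.2.1 ξ.2.2 ≤ K * freqNorm ξ ^ (-α) := by
  set D := Real.sqrt (1 + 1 / c₀ ^ 2)
  refine ⟨(c₀ * D / ℓ) ^ α * δ ^ (-(α + 2) / 2), by positivity, ?_⟩
  rintro ⟨ω, k₂, k₃⟩ hξ
  have hN := freqNorm_pos hξ
  obtain ⟨hω, hη⟩ := hξ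
  simp only at hω hη ⊢
  have hk : c₀ ^ 2 * (k₂ ^ 2 + k₃ ^ 2) < ω ^ 2 := by
    have h1 : c₀ ^ 2 * (k₂ ^ 2 + k₃ ^ 2) / ω ^ 2 < 1 := by linarith
    exact (div_lt_one (by positivity)).1 h1
  refine ⟨layeredTheta_pos hc₀ hℓ hω hk, ?_⟩
  -- away from glancing incidence `|ξ|` is comparable with `ω`
  have hnorm : freqNorm (ω, k₂, k₃) ≤ D * ω := by
    have h1 : k₂ ^ 2 + k₃ ^ 2 ≤ 1 / c₀ ^ 2 * ω ^ 2 := by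
      rw [one_div, inv_mul_eq_div, le_div_iff₀ (by positivity)]
      linarith
    rw [freqNorm, ← Real.sqrt_sq hω.le, ← Real.sqrt_mul (by positivity)]
    exact Real.sqrt_le_sqrt (by simp only [Real.sqrt_sq hω.le]; linarith)
  have h1 : (c₀ / (ℓ * ω)) ^ α ≤ (c₀ * D / ℓ) ^ α * freqNorm (ω, k₂, k₃) ^ (-α) := by
    rw [Real.rpow_neg hN.le, ← Real.inv_rpow hN.le,
      ← Real.mul_rpow (by positivity) (by positivity)]
    refine Real.rpow_le_rpow (by positivity) ?_ hα.le
    rw [← div_eq_mul_inv, div_div, div_le_div_iff₀ (by positivity) (by positivity)]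
    have h2 := mul_le_mul_of_nonneg_left hnorm (by positivity : 0 ≤ c₀ * ℓ)
    linarith
  have h2 : (1 - c₀ ^ 2 * (k₂ ^ 2 + k₃ ^ 2) / ω ^ 2) ^ (-(α + 2) / 2) ≤ δ ^ (-(α + 2) / 2) :=
    Real.rpow_le_rpow_of_nonpos hδ (by linarith) (by linarith)
  calc layeredTheta c₀ ℓ α ω k₂ k₃
      ≤ ((c₀ * D / ℓ) ^ α * freqNorm (ω, k₂, k₃) ^ (-α)) * δ ^ (-(α + 2) / 2) := by
        unfold layeredTheta
        have := Real.rpow_nonneg (one_sub_pos hω hk).le (-(α + 2) / 2)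
        gcongr
    _ = _ := by ring

theorem exists_layeredTheta_lt (hα : 0 < α) (hc₀ : 0 < c₀) (hℓ : 0 < ℓ) {δ θ₀ : ℝ} (hδ : 0 < δ)
    (hθ₀ : 0 < θ₀) : ∃ ρ : ℝ, 0 < ρ ∧ ∀ ξ ∈ nonGlancing c₀ δ, ρ ≤ freqNorm ξ →
      layeredTheta c₀ ℓ α ξ.1 ξ.2.1 ξ.2.2 < θ₀ := by
  obtain ⟨K, hK, hle⟩ := exists_layeredTheta_le hα hc₀ hℓ hδ
  refine ⟨(K / θ₀ + 1) ^ (1 / α), by positivity, fun ξ hξ hρ => (hle ξ hξ).2.trans_lt ?_⟩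
  have hN := freqNorm_pos hξ
  have h1 : K / θ₀ + 1 ≤ freqNorm ξ ^ α := by
    have := Real.rpow_le_rpow (by positivity) hρ hα.le
    rwa [← Real.rpow_mul (by positivity), one_div, inv_mul_cancel₀ hα.ne', Real.rpow_one] at this
  rw [Real.rpow_neg hN.le, ← div_eq_mul_inv, div_lt_iff₀ (Real.rpow_pos_of_pos hN _)]
  have h2 := mul_le_mul_of_nonneg_left h1 hθ₀.le
  have h3 : θ₀ * (K / θ₀ + 1) = K + θ₀ := by field_simp
  linarith

end FractionalReflector

theorem theorem1 (α : ℝ) (hα : 0 < α) :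
    ∃ (R : ℝ → ℂ) (C θ₀ : ℝ), 0 < θ₀ ∧
      -- the model equation: `R θ` is the reflection coefficient, with its expansion
      (∀ θ : ℝ, 0 < θ → θ < θ₀ →
        FractionalReflector.IsModelReflectionCoefficient α θ (R θ) ∧
        ‖R θ - FractionalReflector.leadingCoefficient α * (θ : ℂ)‖ ≤
          C * θ ^ (1 + min (1 / α) 1)) ∧
      -- the layered medium in three dimensions: the coefficient is `R θ(ω, k₂, k₃)`
      (∀ c₀ ℓ ω k₂ k₃ : ℝ, 0 < c₀ → 0 < ℓ → 0 < ω → c₀ ^ 2 * (k₂ ^ 2 + k₃ ^ 2) < ω ^ 2 →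
        FractionalReflector.layeredTheta c₀ ℓ α ω k₂ k₃ < θ₀ →
        FractionalReflector.IsLayeredReflectionCoefficient c₀ ℓ α ω k₂ k₃
          (R (FractionalReflector.layeredTheta c₀ ℓ α ω k₂ k₃))) ∧
      -- away from glancing incidence it is a Fourier multiplier of order `-α` in `(ω, k₂, k₃)`,
      -- up to order `-α - min α 1` equal to its homogeneous leading part
      (∀ c₀ ℓ δ : ℝ, 0 < c₀ → 0 < ℓ → 0 < δ →
        (∃ ρ : ℝ, ∀ ξ ∈ FractionalReflector.nonGlancing c₀ δ,
          ρ ≤ FractionalReflector.freqNorm ξ →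
          FractionalReflector.layeredTheta c₀ ℓ α ξ.1 ξ.2.1 ξ.2.2 < θ₀) ∧
        FractionalReflector.HasMultiplierOrder (-α) (FractionalReflector.nonGlancing c₀ δ)
          (fun ξ => R (FractionalReflector.layeredTheta c₀ ℓ α ξ.1 ξ.2.1 ξ.2.2)) ∧
        FractionalReflector.HasMultiplierOrder (-α - min α 1)
          (FractionalReflector.nonGlancing c₀ δ)
          (fun ξ => R (FractionalReflector.layeredTheta c₀ ℓ α ξ.1 ξ.2.1 ξ.2.2) -
            FractionalReflector.leadingCoefficient α *
              (FractionalReflector.layeredTheta c₀ ℓ α ξ.1 ξ.2.1 ξ.2.2 : ℂ))) := by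
  obtain ⟨K, θ₀, hK, hθ₀, hθ₀1, hexp⟩ :=
    FractionalReflector.exists_reflectionCoeff_expansion hα
  set L := ‖FractionalReflector.leadingCoefficient α‖
  have hβ : 0 ≤ min (1 / α) 1 := le_min (by positivity) zero_le_one
  have hpow : ∀ θ : ℝ, 0 < θ → θ < θ₀ →
      ‖FractionalReflector.reflectionCoeff α θ -
        FractionalReflector.leadingCoefficient α * (θ : ℂ)‖ ≤ K * θ ^ (1 + min (1 / α) 1) := by
    intro θ hθ hθ'
    refine (hexp θ hθ hθ').2.trans ?_
    gcongr
    rw [← Real.rpow_natCast]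
    refine Real.rpow_le_rpow_of_exponent_ge hθ (by linarith) ?_
    push_cast
    linarith [min_le_right (1 / α) 1]
  have hmodel : ∀ θ : ℝ, 0 < θ → θ < θ₀ → FractionalReflector.IsModelReflectionCoefficient α θ
      (FractionalReflector.reflectionCoeff α θ) := fun θ hθ hθ' =>
    FractionalReflector.isModelReflectionCoefficient hα hθ.le (hexp θ hθ hθ').1
  refine ⟨FractionalReflector.reflectionCoeff α, K, θ₀, hθ₀,
    fun θ hθ hθ' => ⟨hmodel θ hθ hθ', hpow θ hθ hθ'⟩, ?_, ?_⟩
  · intro c₀ ℓ ω k₂ k₃ hc₀ hℓ hω hk hθ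
    exact FractionalReflector.IsModelReflectionCoefficient.layered hc₀ hℓ hω hk hα
      (hmodel _ (FractionalReflector.layeredTheta_pos hc₀ hℓ hω hk) hθ)
  · intro c₀ ℓ δ hc₀ hℓ hδ
    obtain ⟨ρ, hρ, hlt⟩ := FractionalReflector.exists_layeredTheta_lt hα hc₀ hℓ hδ hθ₀
    obtain ⟨M, hM, hle⟩ := FractionalReflector.exists_layeredTheta_le hα hc₀ hℓ hδ
    refine ⟨⟨ρ, hlt⟩, ⟨(L + K) * M, ρ, hρ, fun ξ hξ hρξ => ?_⟩,
      ⟨K * M ^ (1 + min (1 / α) 1), ρ, hρ, fun ξ hξ hρξ => ?_⟩⟩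
    · obtain ⟨hpos, hθM⟩ := hle ξ hξ
      have hθ := hlt ξ hξ hρξ
      set θ := FractionalReflector.layeredTheta c₀ ℓ α ξ.1 ξ.2.1 ξ.2.2
      have h1 := (hexp θ hpos hθ).2
      have h2 : K * θ ^ 2 ≤ K * θ := by
        gcongr
        nlinarith
      have h3 := norm_sub_norm_le (FractionalReflector.reflectionCoeff α θ)
        (FractionalReflector.leadingCoefficient α * (θ : ℂ))
      rw [norm_mul, Complex.norm_real, Real.norm_eq_abs, abs_of_pos hpos] at h3
      have h4 := mul_le_mul_of_nonneg_left hθM (by positivity : 0 ≤ L + K)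
      change ‖FractionalReflector.reflectionCoeff α θ‖ ≤ _
      linarith
    · obtain ⟨hpos, hθM⟩ := hle ξ hξ
      have hN := FractionalReflector.freqNorm_pos hξ
      refine (hpow _ hpos (hlt ξ hξ hρξ)).trans ?_
      have h1 := Real.rpow_le_rpow hpos.le hθM (by linarith : 0 ≤ 1 + min (1 / α) 1)
      -- `α min(1/α, 1) = min(α, 1)`
      have h2 : -α * (1 + min (1 / α) 1) = -α - min α 1 := by
        have h3 : α * min (1 / α) 1 = min α 1 := by
          rw [mul_min_of_nonneg _ _ hα.le, mul_one_div_cancel hα.ne', mul_one, min_comm]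
        linear_combination -h3
      rw [Real.mul_rpow hM (by positivity), ← Real.rpow_mul hN.le, h2] at h1
      rw [mul_assoc]
      gcongr
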